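/- Let $F_2$ be the free group on $a,b$, let $L_2=\{a,b,a^{-1},b^{-1}\}$, and identify each element of $F_2$ with its reduced word over $L_2$; $|w|$ is the length of this word. Let $C_2$ be the set of cyclically reduced words, that is, reduced words $x_1\cdots x_n$ with $x_n\neq x_1^{-1}$. An automorphic conjugacy class is an orbit $W$ of $\operatorname{Aut}F_2$ on $F_2$; a word is minimal if its length is least in its class. For a nonempty word $u\in C_2$ of length $k$ and $w=x_1\cdots x_n\in C_2$, let $(u)_w$ be the total number of (possibly overlapping) occurrences of $u$ and $u^{-1}$ as contiguous subwords of $x_1\cdots x_nx_1\cdots x_{k-1}$ if $k\le n$, and $(u)_w=0$ if $k>n$. A word $w\in C_2$ is a root word if $|(ab)_w-(ab^{-1})_w|=(aa)_w=(bb)_w$, and it is alternating if $(aa)_w=0=(bb)_w$. A root class is an automorphic conjugacy class that contains a root word. A permutation is an automorphism of $F_2$ that permutes $L_2$. For $x,y\in L_2$ with $y\notin\{x,x^{-1}\}$, the one-letter automorphism $(\{y\},x)$ is the automorphism with $x\mapsto x$ and $y\mapsto yx$. Let $J\le\operatorname{Aut}F_2$ be the subgroup generated by the inner automorphisms and the permutations,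 and write $w\sim_J v$ if $\phi(w)=v$ for some $\phi\in J$. The directed multigraph $\Gamma(W)$ has as its vertices the $\sim_J$-classes $[w]$ of the minimal words $w\in W$, and it has one edge from $[w]$ to $[v]$ for each class $[\phi]$ modulo $\operatorname{Inn}F_2$ of one-letter automorphisms such that $\phi(w)\in[v]$ (the number of these edges does not depend on the representatives $w$, $v$). Theorem. Let $W$ be a root class that contains no alternating minimal word. Then $\Gamma(W)$ is isomorphic to one of the following directed multigraphs. (R1) One vertex with two loops. (R2) Two vertices $p$, $q$ with exactly two edges from $p$ to $q$, one edge from $q$ to $p$, one loop at $q$, and no loop at $p$. (R3) The bidirected 3-cycle: three vertices, exactly one edge from each vertex to each of the other two, and no loops. -/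

import Mathlib

namespace FreeGroupTwo

/-- The free group of rank two. -/
abbrev F2 : Type := FreeGroup (Fin 2)

/-- The first free generator. -/
def a : F2 := FreeGroup.of 0

/-- The second free generator. -/
def b : F2 := FreeGroup.of 1

/-- The four letters `a, b, a⁻¹, b⁻¹`. -/
def L2 : Set F2 := {a, b, a⁻¹, b⁻¹}

/-- The length of the reduced word representing `w`. -/
def len (w : F2) : ℕ := w.toWord.length

/-- `C2` is the set of reduced words `x₁ ⋯ xₙ` with `xₙ ≠ x₁⁻¹`. -/
def C2 : Set F2 := {w | FreeGroup.IsCyclicallyReduced w.toWord}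

/-- `W` is an automorphic conjugacy class: an orbit of `Aut F₂` on `F₂`. -/
def IsAutomorphicClass (W : Set F2) : Prop :=
  ∃ w : F2, W = {v | ∃ φ : MulAut F2, φ w = v}

/-- `w` has minimal length in its automorphic conjugacy class. -/
def IsMinimal (w : F2) : Prop := ∀ φ : MulAut F2, len w ≤ len (φ w)

/-- The number of (possibly overlapping) occurrences of the nonempty word `u` as a contiguous
subword of the word `l`. -/
def occurrences (u l : List (Fin 2 × Bool)) : ℕ := l.tails.countP (fun t => u.isPrefixOf t)

/-- `(u)_w`, for nonempty `u`: if `k = |u| ≤ |w| = n`, the total number of occurrences of `u` and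
of `u⁻¹` in `x₁ ⋯ xₙ x₁ ⋯ x₍ₖ₋₁₎`, where `w = x₁ ⋯ xₙ`; and `0` if `|u| > |w|`. -/
def subwordCount (u w : F2) : ℕ :=
  if len u ≤ len w then
    occurrences u.toWord (w.toWord ++ w.toWord.take (len u - 1)) +
      occurrences u⁻¹.toWord (w.toWord ++ w.toWord.take (len u - 1))
  else 0

/-- Root words: `|(ab)_w - (ab⁻¹)_w| = (aa)_w = (bb)_w`. -/
def IsRootWord (w : F2) : Prop :=
  w ∈ C2 ∧
    |(subwordCount (a * b) w : ℤ) - (subwordCount (a * b⁻¹) w : ℤ)| = subwordCount (a * a) w ∧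
    subwordCount (a * a) w = subwordCount (b * b) w

/-- Alternating words: `(aa)_w = 0 = (bb)_w`. -/
def IsAlternating (w : F2) : Prop :=
  w ∈ C2 ∧ subwordCount (a * a) w = 0 ∧ subwordCount (b * b) w = 0

/-- A root class is an automorphic conjugacy class containing a root word. -/
def IsRootClass (W : Set F2) : Prop := IsAutomorphicClass W ∧ ∃ w ∈ W, IsRootWord w

/-- A permutation (Type I automorphism) is an automorphism that permutes the letters. -/
def IsPermutation (π : MulAut F2) : Prop := π '' L2 = L2

open Classical in
/-- `φ` is the Type II automorphism `(A, x)`. -/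
def IsTypeII (A : Set F2) (x : F2) (φ : MulAut F2) : Prop :=
  x ∈ L2 ∧ A ⊆ L2 \ {x, x⁻¹} ∧
    ∀ y ∈ L2, φ y = (if y⁻¹ ∈ A then x⁻¹ else 1) * y * (if y ∈ A then x else 1)

/-- A one-letter automorphism is a Type II automorphism `({y}, x)`. -/
def IsOneLetter (φ : MulAut F2) : Prop := ∃ x y : F2, IsTypeII {y} x φ

/-- The normal subgroup of inner automorphisms. -/
def Inn : Subgroup (MulAut F2) := (MulAut.conj : F2 →* MulAut F2).range

instance : Inn.Normal where
  conj_mem := by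
    rintro _ ⟨g, rfl⟩ φ
    refine ⟨φ g, ?_⟩
    ext z
    simp

/-- The subgroup `J` generated by inner automorphisms and permutations. -/
def J : Subgroup (MulAut F2) := Subgroup.closure ((Inn : Set (MulAut F2)) ∪ {π | IsPermutation π})

/-- `w ∼_J v`. -/
def JRel (w v : F2) : Prop := ∃ φ ∈ J, φ w = v

theorem JRel.refl (w : F2) : JRel w w := ⟨1, J.one_mem, rfl⟩

theorem JRel.symm {w v : F2} (h : JRel w v) : JRel v w := by
  obtain ⟨φ, hφ, rfl⟩ := h
  exact ⟨φ⁻¹, J.inv_mem hφ, by simp⟩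

theorem JRel.trans {u v w : F2} (h : JRel u v) (h' : JRel v w) : JRel u w := by
  obtain ⟨φ, hφ, rfl⟩ := h
  obtain ⟨ψ, hψ, rfl⟩ := h'
  exact ⟨ψ * φ, J.mul_mem hψ hφ, rfl⟩

/-- The minimal words in `W`. -/
def MinimalWord (W : Set F2) : Type := {w : F2 // w ∈ W ∧ IsMinimal w}

/-- The relation `∼_J` on the minimal words in `W`. -/
def minimalSetoid (W : Set F2) : Setoid (MinimalWord W) where
  r w v := JRel w.1 v.1
  iseqv := ⟨fun w => JRel.refl w.1, JRel.symm, JRel.trans⟩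

/-- The classes `[φ]` modulo `Inn F₂` of one-letter automorphisms such that `[w]` is connected to
`[v]` by `[φ]`, that is, `φ(w) ∈ [v]`. -/
def connecting (w v : F2) : Set (MulAut F2 ⧸ Inn) :=
  {c | ∃ φ : MulAut F2, IsOneLetter φ ∧ (φ : MulAut F2 ⧸ Inn) = c ∧ JRel (φ w) v}

theorem IsPermutation.inv {π : MulAut F2} (h : IsPermutation π) : IsPermutation π⁻¹ := by
  unfold IsPermutation at h ⊢
  conv_lhs => rw [← h]
  rw [Set.image_image]
  simp

theorem IsPermutation.mem {π : MulAut F2} (h : IsPermutation π) {x : F2} (hx : x ∈ L2) :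
    π x ∈ L2 := by
  unfold IsPermutation at h
  rw [← h]
  exact ⟨x, hx, rfl⟩

theorem IsOneLetter.conj_permutation {π φ : MulAut F2} (hπ : IsPermutation π)
    (h : IsOneLetter φ) : IsOneLetter (π * φ * π⁻¹) := by
  obtain ⟨x, y, hx, hA, hφ⟩ := h
  have hy := hA rfl
  refine ⟨π x, π y, hπ.mem hx, ?_, fun z hz => ?_⟩
  · rintro _ rfl
    refine ⟨hπ.mem hy.1, ?_⟩
    have h2 := hy.2
    simp only [Set.mem_insert_iff, Set.mem_singleton_iff, ← map_inv, EmbeddingLike.apply_eq_iff_eq]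
      at h2 ⊢
    exact h2
  · obtain ⟨t, rfl⟩ := π.surjective z
    have ht : t ∈ L2 := by simpa using hπ.inv.mem hz
    have e : (π * φ * π⁻¹) (π t) = π (φ t) := by simp
    rw [e, hφ t ht]
    simp only [Set.mem_singleton_iff, ← map_inv, EmbeddingLike.apply_eq_iff_eq, map_mul]
    split_ifs <;> simp

theorem IsOneLetter.conj_J {j : MulAut F2} (hj : j ∈ J) :
    ∀ φ, IsOneLetter φ → ∃ φ', IsOneLetter φ' ∧
      (φ' : MulAut F2 ⧸ Inn) = (j : MulAut F2 ⧸ Inn) * φ * (j : MulAut F2 ⧸ Inn)⁻¹ := by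
  have gen : ∀ x : MulAut F2, x ∈ (Inn : Set (MulAut F2)) ∪ {π | IsPermutation π} →
      ∀ φ, IsOneLetter φ → ∃ φ', IsOneLetter φ' ∧
      (φ' : MulAut F2 ⧸ Inn) = (x : MulAut F2 ⧸ Inn) * φ * (x : MulAut F2 ⧸ Inn)⁻¹ := by
    rintro x (hx | hx) φ hφ
    · refine ⟨φ, hφ, ?_⟩
      rw [(QuotientGroup.eq_one_iff x).2 hx]
      simp
    · exact ⟨x * φ * x⁻¹, hφ.conj_permutation hx, rfl⟩
  have hj' : j ∈ Subgroup.closure ((Inn : Set (MulAut F2)) ∪ {π | IsPermutation π}) := hj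
  clear hj
  induction hj' using Subgroup.closure_induction'' with
  | mem x hx => exact gen x hx
  | inv_mem x hx =>
    rcases hx with hx | hx
    · exact gen x⁻¹ (Or.inl (Inn.inv_mem hx))
    · exact gen x⁻¹ (Or.inr (IsPermutation.inv hx))
  | one => exact fun φ hφ => ⟨φ, hφ, by simp⟩
  | mul x y _ _ hx hy =>
    intro φ hφ
    obtain ⟨φ₁, h₁, e₁⟩ := hy φ hφ
    obtain ⟨φ₂, h₂, e₂⟩ := hx φ₁ h₁
    refine ⟨φ₂, h₂, ?_⟩
    rw [e₂, e₁]
    simp [mul_assoc]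

theorem connecting_conj {j : MulAut F2} (hj : j ∈ J) {w v v' : F2} (hv : JRel v v')
    {c : MulAut F2 ⧸ Inn} (hc : c ∈ connecting w v) :
    (j : MulAut F2 ⧸ Inn) * c * (j : MulAut F2 ⧸ Inn)⁻¹ ∈ connecting (j w) v' := by
  obtain ⟨φ, hφ, rfl, hr⟩ := hc
  obtain ⟨φ', hφ', e⟩ := IsOneLetter.conj_J hj φ hφ
  refine ⟨φ', hφ', e, ?_⟩
  have e' : ((j * φ * j⁻¹ : MulAut F2) : MulAut F2 ⧸ Inn) = φ' := by rw [e]; rfl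
  have hm : (j * φ * j⁻¹)⁻¹ * φ' ∈ Inn := QuotientGroup.eq.1 e'
  have hm' : φ' * (j * φ * j⁻¹)⁻¹ ∈ Inn := by
    have := (inferInstance : Inn.Normal).conj_mem _ hm (j * φ * j⁻¹)
    simpa [mul_assoc] using this
  have h1 : JRel (φ w) (φ' (j w)) := by
    refine ⟨φ' * (j * φ * j⁻¹)⁻¹ * j,
      J.mul_mem (Subgroup.subset_closure (Or.inl hm')) hj, ?_⟩
    simp
  exact (h1.symm.trans hr).trans hv

theorem ncard_connecting_congr {w w' v v' : F2} (hw : JRel w w') (hv : JRel v v') :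
    (connecting w v).ncard = (connecting w' v').ncard := by
  obtain ⟨j, hj, rfl⟩ := hw
  have key : (fun c => (j : MulAut F2 ⧸ Inn) * c * (j : MulAut F2 ⧸ Inn)⁻¹) '' connecting w v =
      connecting (j w) v' := by
    apply Set.Subset.antisymm
    · rintro _ ⟨c, hc, rfl⟩
      exact connecting_conj hj hv hc
    · intro c hc
      refine ⟨(j : MulAut F2 ⧸ Inn)⁻¹ * c * j, ?_, by simp [mul_assoc]⟩
      have := connecting_conj (J.inv_mem hj) hv.symm hc
      simpa using this
  rw [← key, Set.ncard_image_of_injective]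
  intro c d h
  simpa using h

/-- A directed multigraph, loops and multiple edges allowed: `edges u v` is the number of edges
from `u` to `v`. -/
structure DirectedMultigraph where
  /-- the vertices -/
  V : Type
  /-- the number of edges from one vertex to another -/
  edges : V → V → ℕ

/-- Isomorphism of directed multigraphs. -/
def DirectedMultigraph.Isomorphic (G H : DirectedMultigraph) : Prop :=
  ∃ e : G.V ≃ H.V, ∀ u v : G.V, G.edges u v = H.edges (e u) (e v)

/-- The graph `Γ(W)`: its vertices are the classes `[w]` of minimal words in `W` modulo `∼_J`, and
there is one edge from `[w]` to `[v]` for each class `[φ]` modulo `Inn F₂` of one-letter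
automorphisms such that `[w]` is connected to `[v]` by `[φ]`. -/
noncomputable def Gam (W : Set F2) : DirectedMultigraph where
  V := Quotient (minimalSetoid W)
  edges := Quotient.lift₂ (fun w v => (connecting w.1 v.1).ncard)
    (fun _ _ _ _ hw hv => ncard_connecting_congr hw hv)

/-- (R1): one vertex with two loops. -/
def R1 : DirectedMultigraph where
  V := Fin 1
  edges := ![![2]]

/-- (R2): two edges from the first vertex to the second, one edge back, and one loop at the
second. -/
def R2 : DirectedMultigraph where
  V := Fin 2
  edges := ![![0, 2], ![1, 1]]

/-- (R3): the bidirected 3-cycle. -/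
def R3 : DirectedMultigraph where
  V := Fin 3
  edges := ![![0, 1, 1], ![1, 0, 1], ![1, 1, 0]]

end FreeGroupTwo

/-!
Up to inner automorphisms, the one-letter automorphisms of `F₂` are the four moves `xᵢ ↦ xᵢyᵢˢ`. On
a cyclically reduced `w` such a move increases the cyclic length by `(xᵢxᵢ)_w` plus or minus
`(ab)_w - (ab⁻¹)_w`, with the sign of `s`; for a root word both moves of one sign therefore preserve
the length. Comparing the two signs shows that the cyclic length is convex along the orbits of a
move, so a word that positive moves leave at least as long as negative ones do is not shortened by
any product of positive moves, and likewise for the other sign. By Nielsen's theorem every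
automorphism is, up to `J`, a product of moves of one sign. Hence, up to `J`, the minimal images of
a root word `w` are `w` and its images under the two moves that preserve its length. The
length-preserving moves at each vertex of this triangle lead to the other two vertices, and the
moves of the opposite sign lengthen unless the vertex is alternating. So `Γ(W)` is the bidirected
3-cycle with some of its vertices identified.
-/

namespace FreeGroupTwo

open FreeGroup (mk of lift lift_mk inv_mk mul_mk invRev mk_toWord toWord_mk toWord_pow
  isReduced_toWord norm_mul_le norm_inv_eq IsCyclicallyReduced reduceCyclically)

section Words

variable {α : Type*} {x y : α × Bool}

/-- The letter inverse to `x`, so that `mk [bar x] = (mk [x])⁻¹`. -/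
def bar (x : α × Bool) : α × Bool := (x.1, !x.2)

@[simp]
theorem bar_bar (x : α × Bool) : bar (bar x) = x := by simp [bar]

@[simp]
theorem bar_fst (x : α × Bool) : (bar x).1 = x.1 := rfl

@[simp]
theorem bar_ne_self (x : α × Bool) : bar x ≠ x := by simp [bar, Prod.ext_iff]

@[simp]
theorem self_ne_bar (x : α × Bool) : x ≠ bar x := (bar_ne_self x).symm

theorem mk_bar (x : α × Bool) : mk [bar x] = (mk [x])⁻¹ := by simp [inv_mk, invRev, bar]

theorem mk_cons (x : α × Bool) (l : List (α × Bool)) :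
    mk (x :: l) = mk [x] * mk l := by
  rw [mul_mk, List.singleton_append]

theorem isReduced_cons_iff {l : List (α × Bool)} :
    FreeGroup.IsReduced (x :: l) ↔ l.head? ≠ some (bar x) ∧ FreeGroup.IsReduced l := by
  rw [FreeGroup.IsReduced, List.isChain_cons]
  refine and_congr_left fun _ => ⟨fun h hx => by simpa [bar] using h _ hx, fun h z hz hzx => ?_⟩
  by_contra hne
  exact h (by rw [hz, show z = bar x from Prod.ext hzx.symm (Bool.eq_not.2 (Ne.symm hne))])

variable [DecidableEq α]

/-- The number of positions in a word at which the two-letter word `xy` or its inverse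
`bar y, bar x` begins. -/
def pairCount (x y : α × Bool) : List (α × Bool) → ℕ
  | [] => 0
  | p :: t => (if p = x ∧ t.head? = some y then 1 else 0) +
      (if p = bar y ∧ t.head? = some (bar x) then 1 else 0) + pairCount x y t

/-- The number of occurrences of the letter `x` and of its inverse in a word. -/
def letterCount (x : α × Bool) (l : List (α × Bool)) : ℕ := l.count x + l.count (bar x)

/-- The number of occurrences of `xy` and of its inverse in a word read cyclically. -/
def cyclicPairCount (x y : α × Bool) (l : List (α × Bool)) : ℕ := pairCount x y (l ++ l.take 1)

theorem pairCount_append (x y : α × Bool) (l m : List (α × Bool)) :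
    pairCount x y (l ++ m) = pairCount x y (l ++ m.take 1) + pairCount x y m := by
  induction l with
  | nil => cases m <;> simp [pairCount]
  | cons p t ih =>
    have h : (t ++ m.take 1).head? = (t ++ m).head? := by cases t <;> cases m <;> simp
    simp only [List.cons_append, pairCount, ih, h, add_assoc]

theorem pairCount_flatten_replicate (x y : α × Bool) (l : List (α × Bool)) (n : ℕ) :
    pairCount x y (List.replicate (n + 1) l).flatten =
      n * cyclicPairCount x y l + pairCount x y l := by
  induction n with
  | zero => simp
  | succ n ih =>
    have h : (List.replicate (n + 1) l).flatten.take 1 = l.take 1 := by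
      cases l <;> simp [List.replicate_succ]
    rw [List.replicate_succ, List.flatten_cons, pairCount_append, ih, h, cyclicPairCount]
    ring

theorem pairCount_bar (x y : α × Bool) (l : List (α × Bool)) :
    pairCount (bar y) (bar x) l = pairCount x y l := by
  induction l with
  | nil => rfl
  | cons p t ih => simp only [pairCount, bar_bar, ih]; ring

theorem letterCount_cons (x p : α × Bool) (t : List (α × Bool)) :
    letterCount x (p :: t) =
      (if p = x then 1 else 0) + (if p = bar x then 1 else 0) + letterCount x t := by
  simp only [letterCount, List.count_cons, beq_iff_eq]; ring

theorem letterCount_bar (x : α × Bool) (l : List (α × Bool)) :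
    letterCount (bar x) l = letterCount x l := by
  simp only [letterCount, bar_bar, add_comm]

theorem letterCount_flatten_replicate (x : α × Bool) (l : List (α × Bool)) (n : ℕ) :
    letterCount x (List.replicate n l).flatten = n * letterCount x l := by
  simp only [letterCount, List.count_flatten, List.map_replicate, List.sum_replicate, smul_eq_mul,
    mul_add]

/-- The substitution `x ↦ xy`, `x⁻¹ ↦ y⁻¹x⁻¹` on words, with the cancellations inside
`x y⁻¹ ↦ (x y) y⁻¹` and `y x⁻¹ ↦ y (y⁻¹ x⁻¹)` carried out. -/
def transvectWord (x y : α × Bool) : List (α × Bool) → List (α × Bool)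
  | [] => []
  | p :: t =>
    if p = x then
      if t.head? = some (bar y) then x :: (transvectWord x y t).tail
      else x :: y :: transvectWord x y t
    else if p = bar x then bar y :: bar x :: transvectWord x y t
    else if p = y ∧ t.head? = some (bar x) then (transvectWord x y t).tail
    else p :: transvectWord x y t

theorem transvectWord_cons_bar_fst (t : List (α × Bool)) :
    transvectWord x y (bar x :: t) = bar y :: bar x :: transvectWord x y t := by
  simp [transvectWord]

theorem transvectWord_cons_bar_snd (hxy : x.1 ≠ y.1) (t : List (α × Bool)) :
    transvectWord x y (bar y :: t) = bar y :: transvectWord x y t := by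
  have h₁ : bar y ≠ x := fun h => hxy (by simp [← h])
  have h₂ : bar y ≠ bar x := fun h => hxy (by simpa using congrArg Prod.fst h.symm)
  simp [transvectWord, h₁, h₂]

/-- Where the substitution cancels, its value on the remaining word begins with `y⁻¹`. -/
theorem bar_cons_tail_transvectWord (hxy : x.1 ≠ y.1) {t : List (α × Bool)}
    (h : t.head? = some (bar x) ∨ t.head? = some (bar y)) :
    bar y :: (transvectWord x y t).tail = transvectWord x y t := by
  rcases h with h | h <;> obtain ⟨t, rfl⟩ := List.head?_eq_some_iff.1 h
  · simp [transvectWord_cons_bar_fst]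
  · simp [transvectWord_cons_bar_snd hxy]

theorem head_transvectWord {z : α × Bool} {l : List (α × Bool)}
    (hz : (transvectWord x y l).head? = some z) :
    (l.head? = some z ∧ z ≠ bar x) ∨ (l.head? = some (bar x) ∧ z = bar y) ∨
      (l.head? = some y ∧ z = bar x) := by
  cases l with
  | nil => simp [transvectWord] at hz
  | cons p t =>
    rw [transvectWord] at hz
    split_ifs at hz with h₁ h₂ h₃ h₄
    · simp_all
    · simp_all
    · simp_all
    · obtain ⟨t, rfl⟩ := List.head?_eq_some_iff.1 h₄.2
      simp_all [transvectWord_cons_bar_fst]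
    · simp_all

theorem isReduced_transvectWord (hxy : x.1 ≠ y.1) {l : List (α × Bool)}
    (h : FreeGroup.IsReduced l) : FreeGroup.IsReduced (transvectWord x y l) := by
  induction l with
  | nil => exact h
  | cons p t ih =>
    obtain ⟨hp, ht⟩ := isReduced_cons_iff.1 h
    specialize ih ht
    have hxy₁ : x ≠ y := fun h => hxy (by rw [h])
    have hxy₂ : y ≠ bar x := fun h => hxy (by rw [h, bar_fst])
    rw [transvectWord]
    split_ifs with h₁ h₂ h₃ h₄
    · obtain ⟨t, rfl⟩ := List.head?_eq_some_iff.1 h₂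
      rw [transvectWord_cons_bar_snd hxy, isReduced_cons_iff] at ih
      rw [isReduced_cons_iff] at ht
      rw [transvectWord_cons_bar_snd hxy, List.tail_cons, isReduced_cons_iff]
      exact ⟨fun hz => by grind [head_transvectWord hz, bar_bar], ih.2⟩
    · simp only [isReduced_cons_iff, List.head?_cons, ne_eq, Option.some.injEq]
      exact ⟨hxy₂, fun hz => by grind [head_transvectWord hz, bar_bar, bar_ne_self], ih⟩
    · simp only [isReduced_cons_iff, List.head?_cons, ne_eq, Option.some.injEq, bar_bar]
      exact ⟨hxy₂.symm, fun hz => by grind [head_transvectWord hz, bar_bar], ih⟩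
    · rw [← bar_cons_tail_transvectWord hxy (.inl h₄.2)] at ih
      exact (isReduced_cons_iff.1 ih).2
    · exact isReduced_cons_iff.2 ⟨fun hz => by grind [head_transvectWord hz, bar_bar], ih⟩

theorem length_transvectWord (hxy : x.1 ≠ y.1) (l : List (α × Bool)) :
    (transvectWord x y l).length + 2 * pairCount x (bar y) l = l.length + letterCount x l := by
  induction l with
  | nil => simp [transvectWord, pairCount, letterCount]
  | cons p t ih =>
    have hlen (h : t.head? = some (bar x) ∨ t.head? = some (bar y)) :=
      congrArg List.length (bar_cons_tail_transvectWord hxy h)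
    have hxy' : x ≠ y := fun h => hxy (by rw [h])
    rw [transvectWord, pairCount, letterCount_cons]
    split_ifs <;> simp_all <;> omega

end Words

section Transvection

variable {α : Type*} [DecidableEq α] {i : α} {y : α × Bool}

theorem lift_update_of_mk_singleton (h : i ≠ y.1) (g : FreeGroup α) :
    lift (Function.update of i g) (mk [y]) = mk [y] := by
  obtain ⟨j, s⟩ := y
  cases s <;> simp [lift_mk, Function.update_of_ne (Ne.symm h), of, inv_mk, invRev]

theorem lift_update_comp_lift_update (h : i ≠ y.1) :
    (lift (Function.update of i (of i * mk [bar y]))).comp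
      (lift (Function.update of i (of i * mk [y]))) = MonoidHom.id (FreeGroup α) := by
  ext j
  rcases eq_or_ne j i with rfl | hj
  · simp [-lift_mk, lift_update_of_mk_singleton h, mk_bar, -inv_mk]
  · simp [Function.update_of_ne hj]

/-- The automorphism of a free group with `i ↦ i * y`, for a letter `y ≠ i, i⁻¹`, that fixes the
other free generators. -/
def transvection (i : α) (y : α × Bool) (h : i ≠ y.1) : MulAut (FreeGroup α) :=
  MonoidHom.toMulEquiv (lift (Function.update of i (of i * mk [y])))
    (lift (Function.update of i (of i * mk [bar y])))
    (lift_update_comp_lift_update h)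
    (by simpa only [bar_bar] using lift_update_comp_lift_update (y := bar y) h)

theorem transvection_of_self (h : i ≠ y.1) : transvection i y h (of i) = of i * mk [y] := by
  simp [transvection]

theorem transvection_mk_of_ne (h : i ≠ y.1) {z : α × Bool} (hz : z.1 ≠ i) :
    transvection i y h (mk [z]) = mk [z] :=
  lift_update_of_mk_singleton hz.symm _

theorem inv_transvection (h : i ≠ y.1) : (transvection i y h)⁻¹ = transvection i (bar y) h := by
  ext w
  simp [transvection, MulAut.inv_def]

theorem mk_transvectWord (h : i ≠ y.1) (l : List (α × Bool)) :
    mk (transvectWord (i, true) y l) = transvection i y h (mk l) := by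
  have hcancel {t : List (α × Bool)}
      (ht : t.head? = some (bar (i, true)) ∨ t.head? = some (bar y)) :
      mk (transvectWord (i, true) y t).tail = mk [y] * mk (transvectWord (i, true) y t) := by
    rw [← bar_cons_tail_transvectWord h ht, List.tail_cons,
      mk_cons (bar y) (List.tail _), mk_bar, mul_inv_cancel_left]
  have hi : transvection i y h (mk [(i, true)]) = mk [(i, true)] * mk [y] := transvection_of_self h
  induction l with
  | nil => exact (map_one _).symm
  | cons p t ih =>
    rw [mk_cons p t, map_mul, ← ih, transvectWord]
    split_ifs with h₁ h₂ h₃ h₄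
    · rw [mk_cons, hcancel (.inr h₂), h₁, hi, mul_assoc]
    · rw [mk_cons _ (_ :: _), mk_cons _ (transvectWord _ _ _), h₁, hi, mul_assoc]
    · rw [mk_cons _ (_ :: _), mk_cons _ (transvectWord _ _ _), h₃, mk_bar, mk_bar, map_inv, hi,
        mul_inv_rev, mul_assoc]
    · rw [hcancel (.inl h₄.2), h₄.1, transvection_mk_of_ne h h.symm]
    · have hp : p.1 ≠ i := by
        rintro rfl
        obtain ⟨j, s⟩ := p
        cases s <;> simp_all [bar]
      rw [mk_cons, transvection_mk_of_ne h hp]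

end Transvection

section CyclicLength

variable {α : Type*} [DecidableEq α]

/-- The length of the cyclic reduction of `w`, that is, the minimal length in its conjugacy
class. -/
def cyclicLen (w : FreeGroup α) : ℕ := (reduceCyclically w.toWord).length

/-- The growth of the powers of `w` determines `cyclicLen w`. -/
theorem norm_pow_succ (w : FreeGroup α) (n : ℕ) : (w ^ (n + 1)).norm =
    (n + 1) * cyclicLen w + 2 * (reduceCyclically.conjugator w.toWord).length := by
  rw [FreeGroup.norm, toWord_pow, reduceCyclically.reduce_flatten_replicate_succ isReduced_toWord]
  simp only [cyclicLen, List.length_append, List.length_flatten, List.map_replicate,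
    List.sum_replicate, smul_eq_mul, FreeGroup.invRev_length]
  ring

theorem norm_eq_cyclicLen_add (w : FreeGroup α) :
    w.norm = cyclicLen w + 2 * (reduceCyclically.conjugator w.toWord).length := by
  simpa using norm_pow_succ w 0

theorem cyclicLen_le_norm (w : FreeGroup α) : cyclicLen w ≤ w.norm := by
  rw [norm_eq_cyclicLen_add w]; exact Nat.le_add_right _ _

theorem cyclicLen_le_of_norm_pow_le {v w : FreeGroup α} (c : ℕ)
    (h : ∀ n, (v ^ n).norm ≤ (w ^ n).norm + c) : cyclicLen v ≤ cyclicLen w := by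
  by_contra! hlt
  set d := 2 * (reduceCyclically.conjugator w.toWord).length + c with hd
  have := h (d + 1)
  rw [norm_pow_succ, norm_pow_succ] at this
  nlinarith

theorem cyclicLen_conj (g w : FreeGroup α) : cyclicLen (g * w * g⁻¹) = cyclicLen w := by
  have hle (g w : FreeGroup α) : cyclicLen (g * w * g⁻¹) ≤ cyclicLen w := by
    refine cyclicLen_le_of_norm_pow_le (2 * g.norm) fun n => ?_
    rw [conj_pow]
    have := norm_mul_le (g * w ^ n) g⁻¹
    have := norm_mul_le g (w ^ n)
    rw [norm_inv_eq] at *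
    omega
  refine (hle g w).antisymm ?_
  simpa [mul_assoc] using hle g⁻¹ (g * w * g⁻¹)

theorem toWord_pow_of_isCyclicallyReduced {w : FreeGroup α} (hw : IsCyclicallyReduced w.toWord)
    (n : ℕ) : (w ^ n).toWord = (List.replicate n w.toWord).flatten := by
  rw [toWord_pow, (hw.flatten_replicate n).isReduced.reduce_eq]

theorem cyclicLen_of_isCyclicallyReduced {w : FreeGroup α} (hw : IsCyclicallyReduced w.toWord) :
    cyclicLen w = w.norm := by
  have h₁ := norm_pow_succ w 0
  have h₂ := norm_pow_succ w 1
  rw [FreeGroup.norm, toWord_pow_of_isCyclicallyReduced hw] at h₁ h₂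
  simp only [List.length_flatten, List.map_replicate, List.sum_replicate, smul_eq_mul] at h₁ h₂
  rw [FreeGroup.norm]
  omega

theorem exists_conj_isCyclicallyReduced (w : FreeGroup α) :
    ∃ g : FreeGroup α, IsCyclicallyReduced (g * w * g⁻¹).toWord := by
  have hc := reduceCyclically.isCyclicallyReduced (isReduced_toWord (x := w))
  refine ⟨(mk (reduceCyclically.conjugator w.toWord))⁻¹, ?_⟩
  have hconj : (mk (reduceCyclically.conjugator w.toWord))⁻¹ * w *
      (mk (reduceCyclically.conjugator w.toWord))⁻¹⁻¹ = mk (reduceCyclically w.toWord) := by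
    have h := congrArg mk (reduceCyclically.conj_conjugator_reduceCyclically w.toWord)
    rw [mk_toWord, ← mul_mk, ← mul_mk, ← inv_mk] at h
    conv_lhs => enter [1, 2]; rw [← h]
    group
  rwa [hconj, toWord_mk, hc.isReduced.reduce_eq]

theorem cyclicLen_transvection {i : α} {y : α × Bool} (h : i ≠ y.1) {w : FreeGroup α}
    (hw : IsCyclicallyReduced w.toWord) :
    cyclicLen (transvection i y h w) + 2 * cyclicPairCount (i, true) (bar y) w.toWord =
      w.norm + letterCount (i, true) w.toWord := by
  have hpow (n : ℕ) : (transvection i y h w ^ (n + 1)).norm +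
      2 * (n * cyclicPairCount (i, true) (bar y) w.toWord + pairCount (i, true) (bar y) w.toWord) =
      (n + 1) * (w.norm + letterCount (i, true) w.toWord) := by
    have hlen := length_transvectWord (x := (i, true)) h (w ^ (n + 1)).toWord
    have hred := isReduced_transvectWord (x := (i, true)) h (w ^ (n + 1)).isReduced_toWord
    rw [← map_pow, ← mk_toWord (x := w ^ (n + 1)), ← mk_transvectWord h, FreeGroup.norm, toWord_mk,
      hred.reduce_eq]
    rw [toWord_pow_of_isCyclicallyReduced hw] at hlen ⊢
    rw [← pairCount_flatten_replicate, hlen, letterCount_flatten_replicate]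
    simp [FreeGroup.norm, mul_add]
  have h₀ := hpow 0
  have h₁ := hpow 1
  rw [norm_pow_succ] at h₀ h₁
  omega

end CyclicLength

section CommonPrefix

variable {α : Type*} [DecidableEq α]

/-- The length of the longest common prefix of two words. -/
def commonPrefixLength : List α → List α → ℕ
  | p :: s, q :: t => if p = q then commonPrefixLength s t + 1 else 0
  | _, _ => 0

theorem commonPrefixLength_comm (l m : List α) :
    commonPrefixLength l m = commonPrefixLength m l := by
  induction l generalizing m with
  | nil => cases m <;> rfl
  | cons p l ih => cases m <;> simp only [commonPrefixLength, ih, eq_comm]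

theorem min_commonPrefixLength_le (l m k : List α) :
    min (commonPrefixLength l m) (commonPrefixLength m k) ≤ commonPrefixLength l k := by
  induction l generalizing m k with
  | nil => simp [commonPrefixLength]
  | cons p l ih =>
    rcases m with - | ⟨q, m⟩ <;> rcases k with - | ⟨r, k⟩ <;> simp only [commonPrefixLength] <;>
      try simp
    have := ih m k
    split_ifs <;> simp_all

theorem take_commonPrefixLength (l m : List α) :
    l.take (commonPrefixLength l m) = m.take (commonPrefixLength l m) := by
  fun_induction commonPrefixLength l m with
  | case1 s q t ih => simp [ih]
  | case2 => simp
  | case3 => simp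

theorem norm_mk_of_isReduced {l : List (α × Bool)} (h : FreeGroup.IsReduced l) :
    (mk l).norm = l.length := by
  rw [FreeGroup.norm, toWord_mk, h.reduce_eq]

theorem norm_inv_mk_mul_mk {l m : List (α × Bool)} (hl : FreeGroup.IsReduced l)
    (hm : FreeGroup.IsReduced m) :
    ((mk l)⁻¹ * mk m).norm + 2 * commonPrefixLength l m = l.length + m.length := by
  fun_induction commonPrefixLength l m with
  | case1 s q t ih =>
    have hcancel : (mk (q :: s))⁻¹ * mk (q :: t) = (mk s)⁻¹ * mk t := by
      rw [mk_cons q s, mk_cons q t]; group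
    rw [hcancel, List.length_cons, List.length_cons, ← add_add_add_comm,
      ← ih hl.tail hm.tail]
    ring
  | case2 p s q t h =>
    have hred : FreeGroup.IsReduced (invRev (p :: s) ++ q :: t) := by
      have hl' : FreeGroup.IsReduced (invRev (p :: s)) := by
        rw [FreeGroup.isReduced_iff_reduce_eq, FreeGroup.reduce_invRev, hl.reduce_eq]
      refine List.IsChain.append hl' hm ?_
      rcases p with ⟨i, _ | _⟩ <;> rcases q with ⟨j, _ | _⟩ <;> simp_all [invRev]
    rw [inv_mk, mul_mk, norm_mk_of_isReduced hred]
    simp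
  | case3 l m h =>
    rcases l with - | ⟨p, l⟩
    · simp [← FreeGroup.one_eq_mk, norm_mk_of_isReduced hm]
    · rcases m with - | ⟨q, m⟩
      · simp [← FreeGroup.one_eq_mk, norm_inv_eq, norm_mk_of_isReduced hl, -inv_mk]
      · exact (h p l q m rfl rfl).elim

/-- The length of the longest common prefix of the reduced words of `u` and `v`. -/
def commonPrefix (u v : FreeGroup α) : ℕ := commonPrefixLength u.toWord v.toWord

theorem norm_inv_mul (u v : FreeGroup α) :
    (u⁻¹ * v).norm + 2 * commonPrefix u v = u.norm + v.norm := by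
  have h := norm_inv_mk_mul_mk u.isReduced_toWord v.isReduced_toWord
  rwa [mk_toWord, mk_toWord] at h

theorem commonPrefix_comm (u v : FreeGroup α) : commonPrefix u v = commonPrefix v u :=
  commonPrefixLength_comm _ _

theorem min_commonPrefix_le (u v w : FreeGroup α) :
    min (commonPrefix u v) (commonPrefix v w) ≤ commonPrefix u w :=
  min_commonPrefixLength_le _ _ _

theorem commonPrefix_mul (u v : FreeGroup α) :
    commonPrefix u (u * v) + commonPrefix u⁻¹ v = u.norm := by
  have h₁ := norm_inv_mul u (u * v)
  have h₂ := norm_inv_mul u⁻¹ v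
  rw [inv_mul_cancel_left] at h₁
  rw [inv_inv, norm_inv_eq] at h₂
  omega

theorem cyclicLen_eq_zero {w : FreeGroup α} : cyclicLen w = 0 ↔ w = 1 := by
  refine ⟨fun h => ?_, fun h => ?_⟩
  · obtain ⟨g, hg⟩ := exists_conj_isCyclicallyReduced w
    rw [← cyclicLen_conj g, cyclicLen_of_isCyclicallyReduced hg, FreeGroup.norm_eq_zero] at h
    simpa using h
  · simpa [h] using cyclicLen_le_norm w

theorem two_mul_commonPrefix_inv_lt {u : FreeGroup α} (hu : u ≠ 1) :
    2 * commonPrefix u⁻¹ u < u.norm := by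
  have h₀ := norm_pow_succ u 0
  have h₁ := norm_pow_succ u 1
  have h₂ := norm_inv_mul u⁻¹ u
  have h₃ := cyclicLen_eq_zero.not.2 hu
  simp only [inv_inv, norm_inv_eq, zero_add, one_mul, pow_succ, pow_zero] at h₀ h₁ h₂
  omega

/-- The factorization behind the second kind of Nielsen reduction: if half of `u` is a prefix of `v`
and the other half is a suffix of `v`, then `QP` and `m` replace `u = PQ` and `v = PmQ`. -/
theorem exists_factorization_of_commonPrefix {u v : FreeGroup α} {h : ℕ} (hu : 2 * h = u.norm)
    (huv : u.norm ≤ v.norm) (hpre : commonPrefix v u = h) (hsuf : commonPrefix u⁻¹ v⁻¹ = h) :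
    ∃ P Q m : FreeGroup α, u = P * Q ∧ v = P * m * Q ∧ (Q * P).norm ≤ u.norm ∧
      m.norm + u.norm ≤ v.norm := by
  have hpre' := take_commonPrefixLength v.toWord u.toWord
  have hsuf' := take_commonPrefixLength u⁻¹.toWord v⁻¹.toWord
  rw [commonPrefix] at hpre hsuf
  rw [FreeGroup.norm, FreeGroup.norm] at *
  have hbar : Function.Injective fun x : α × Bool => (x.1, !x.2) := fun x y h => by
    simpa [Prod.ext_iff] using h
  rw [hpre] at hpre'
  rw [hsuf, FreeGroup.toWord_inv, FreeGroup.toWord_inv, invRev, invRev, List.take_reverse,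
    List.take_reverse, List.reverse_inj, ← List.map_drop, ← List.map_drop,
    (List.map_injective_iff.2 hbar).eq_iff, List.length_map, List.length_map,
    show u.toWord.length - h = h by omega] at hsuf'
  set n := v.toWord.length - h
  have hmid : v.toWord.take h ++ (v.toWord.take n).drop h = v.toWord.take n := by
    conv_rhs => rw [← List.take_append_drop h (v.toWord.take n), List.take_take,
      min_eq_left (by omega)]
  refine ⟨mk (u.toWord.take h), mk (u.toWord.drop h), mk ((v.toWord.take n).drop h), ?_, ?_, ?_, ?_⟩
  · rw [mul_mk, List.take_append_drop, mk_toWord]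
  · rw [← hpre', hsuf', mul_mk, mul_mk, hmid, List.take_append_drop, mk_toWord]
  · rw [mul_mk]
    refine FreeGroup.norm_mk_le.trans ?_
    simp only [List.length_append, List.length_drop, List.length_take]
    omega
  · have : (mk ((v.toWord.take n).drop h)).norm ≤ _ := FreeGroup.norm_mk_le
    simp only [List.length_drop, List.length_take] at this
    omega

end CommonPrefix

section Nielsen

variable {α β : Type*} [DecidableEq β] {φ : FreeGroup α →* FreeGroup β}

/-- The images of the letters under `φ` form a Nielsen reduced system: in a product of two of them
at most half of each factor cancels, and in a product of three of them something of the middle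
factor survives. -/
structure IsNielsenReduced (φ : FreeGroup α →* FreeGroup β) : Prop where
  intro ::
  two_mul_commonPrefix_le {p q : α × Bool} (h : p ≠ q) :
    2 * commonPrefix (φ (mk [p])) (φ (mk [q])) ≤ (φ (mk [p])).norm
  commonPrefix_add_commonPrefix_lt {p r q : α × Bool} (hr : r ≠ bar p) (hq : q ≠ bar r) :
    commonPrefix (φ (mk [bar p])) (φ (mk [r])) + commonPrefix (φ (mk [bar r])) (φ (mk [q])) <
      (φ (mk [r])).norm

theorem IsNielsenReduced.length_add_commonPrefix_le (hφ : IsNielsenReduced φ)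
    (t : List (α × Bool)) {p r : α × Bool} (hred : FreeGroup.IsReduced (p :: t)) (hpr : p ≠ bar r) :
    commonPrefix (φ (mk [bar r])) (φ (mk (p :: t))) =
        commonPrefix (φ (mk [bar r])) (φ (mk [p])) ∧
      (p :: t).length + commonPrefix (φ (mk [bar r])) (φ (mk [p])) ≤ (φ (mk (p :: t))).norm := by
  induction t generalizing p r with
  | nil =>
    have := hφ.commonPrefix_add_commonPrefix_lt hpr (self_ne_bar p)
    rw [List.length_singleton]
    exact ⟨rfl, by omega⟩
  | cons q t ih =>
    obtain ⟨hq, ht⟩ := isReduced_cons_iff.1 hred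
    have hqp : q ≠ bar p := fun h => hq (by rw [List.head?_cons, h])
    obtain ⟨hprefix, hnorm⟩ := ih ht hqp
    have h₁ := hφ.commonPrefix_add_commonPrefix_lt hpr hqp
    have h₂ := commonPrefix_mul (φ (mk [p])) (φ (mk (q :: t)))
    have h₃ := norm_inv_mul (φ (mk [p]))⁻¹ (φ (mk (q :: t)))
    rw [← map_inv, ← mk_bar, ← map_mul, ← mk_cons, hprefix] at h₂
    rw [inv_inv, ← map_mul, ← mk_cons, ← map_inv, ← mk_bar, hprefix, mk_bar, map_inv,
      norm_inv_eq, ← map_inv, ← mk_bar] at h₃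
    have h₄ := min_commonPrefix_le (φ (mk [bar r])) (φ (mk [p])) (φ (mk (p :: q :: t)))
    have h₅ := min_commonPrefix_le (φ (mk [bar r])) (φ (mk (p :: q :: t))) (φ (mk [p]))
    have h₆ := hφ.two_mul_commonPrefix_le hqp.symm
    rw [commonPrefix_comm (φ (mk (p :: q :: t)))] at h₅
    simp only [List.length_cons] at hnorm ⊢
    constructor <;> omega

theorem IsNielsenReduced.norm_le [DecidableEq α] (hφ : IsNielsenReduced φ) (g : FreeGroup α) :
    g.norm ≤ (φ g).norm := by
  rw [FreeGroup.norm]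
  conv_rhs => rw [← mk_toWord (x := g)]
  have hg := g.isReduced_toWord
  rcases h : g.toWord with - | ⟨p, t⟩
  · exact Nat.zero_le _
  · rw [h] at hg
    exact (Nat.le_add_right _ _).trans
      (hφ.length_add_commonPrefix_le t hg (self_ne_bar p)).2

end Nielsen

section Moves

variable {φ ψ π : MulAut F2} {p q : Fin 2 × Bool}

theorem eq_or_eq_bar_of_fst_eq {α : Type*} {x y : α × Bool} (h : x.1 = y.1) :
    x = y ∨ x = bar y := by
  obtain ⟨i, s⟩ := x
  obtain ⟨j, t⟩ := y
  obtain rfl : i = j := h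
  cases s <;> cases t <;> simp [bar]

theorem mk_singleton_inj {α : Type*} {x y : α × Bool} : mk [x] = mk [y] ↔ x = y :=
  ⟨fun h => by classical simpa using congrArg FreeGroup.toWord h, fun h => by rw [h]⟩

theorem fst_eq_or_fst_eq (h : p.1 ≠ q.1) (r : Fin 2 × Bool) : r.1 = p.1 ∨ r.1 = q.1 := by
  omega

theorem mulAut_ext (h : p.1 ≠ q.1) (hp : φ (mk [p]) = ψ (mk [p]))
    (hq : φ (mk [q]) = ψ (mk [q])) : φ = ψ := by
  have key {r z : Fin 2 × Bool} (hz : φ (mk [z]) = ψ (mk [z])) (hr : r.1 = z.1) :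
      φ (mk [r]) = ψ (mk [r]) := by
    rcases eq_or_eq_bar_of_fst_eq hr with rfl | rfl
    · exact hz
    · rw [mk_bar, map_inv, map_inv, hz]
  refine MulEquiv.toMonoidHom_injective (FreeGroup.ext_hom _ _ fun i => ?_)
  exact (fst_eq_or_fst_eq h (i, true)).elim (key hp) (key hq)

theorem ne_one_sub (i : Fin 2) : i ≠ 1 - i := by
  decide +revert

/-- The automorphism `x ↦ xyˢ`, `y ↦ y`, where `x` is the `i`th generator and `y` the other one. -/
def move (i : Fin 2) (s : Bool) : MulAut F2 := transvection i (1 - i, s) (ne_one_sub i)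

theorem move_mk_self (i : Fin 2) (s : Bool) :
    move i s (mk [(i, true)]) = mk [(i, true)] * mk [(1 - i, s)] :=
  transvection_of_self _

theorem move_mk_of_ne {i : Fin 2} (s : Bool) (h : p.1 ≠ i) : move i s (mk [p]) = mk [p] :=
  transvection_mk_of_ne _ h

theorem inv_move (i : Fin 2) (s : Bool) : (move i s)⁻¹ = move i (!s) := inv_transvection _

theorem mem_L2_iff {x : F2} : x ∈ L2 ↔ ∃ p, x = mk [p] := by
  simp only [L2, Set.mem_insert_iff, Set.mem_singleton_iff, Prod.exists, Fin.exists_fin_two,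
    Bool.exists_bool]
  change _ ↔ (x = a⁻¹ ∨ x = a) ∨ (x = b⁻¹ ∨ x = b)
  tauto

theorem mem_L2_iff_norm_eq_one {x : F2} : x ∈ L2 ↔ x.norm = 1 := by
  rw [mem_L2_iff]
  refine ⟨?_, fun h => ?_⟩
  · rintro ⟨p, rfl⟩
    rfl
  · obtain ⟨p, hp⟩ := List.length_eq_one_iff.1 h
    exact ⟨p, by rw [← hp, mk_toWord]⟩

theorem isPermutation_of_forall_mem (h : ∀ x ∈ L2, π x ∈ L2) : IsPermutation π :=
  Set.eq_of_subset_of_ncard_le (Set.image_subset_iff.2 h)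
    (Set.ncard_image_of_injective _ π.injective).ge (by simp [L2])

theorem isPermutation_of_norm_le (h : ∀ g, g.norm ≤ (φ g).norm) : IsPermutation φ := by
  rw [← inv_inv φ]
  refine IsPermutation.inv (isPermutation_of_forall_mem fun x hx => ?_)
  rw [mem_L2_iff_norm_eq_one] at hx ⊢
  have hle := h (φ⁻¹ x)
  have hne : (φ⁻¹ x).norm ≠ 0 := by
    rw [Ne, FreeGroup.norm_eq_zero, map_eq_one_iff _ (φ⁻¹).injective, ← FreeGroup.norm_eq_zero]
    omega
  rw [MulAut.apply_inv_self] at hle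
  omega

theorem IsPermutation.mem_J (h : IsPermutation π) : π ∈ J :=
  Subgroup.subset_closure (.inr h)

theorem conj_mem_J (g : F2) : MulAut.conj g ∈ J :=
  Subgroup.subset_closure (.inl ⟨g, rfl⟩)

/-- The permutation `x ↦ y⁻ˢ`, `y ↦ xˢ`, where `x` is the `i`th generator and `y` the other one. -/
def quarterTurn (i : Fin 2) (s : Bool) : MulAut F2 :=
  MonoidHom.toMulEquiv
    (lift fun k => if k = i then mk [(1 - i, !s)] else mk [(i, s)])
    (lift fun k => if k = i then mk [(1 - i, s)] else mk [(i, !s)])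
    (by ext k; revert k i s; decide) (by ext k; revert k i s; decide)

theorem isPermutation_quarterTurn (i : Fin 2) (s : Bool) : IsPermutation (quarterTurn i s) :=
  isPermutation_of_forall_mem fun x hx => by
    obtain ⟨p, rfl⟩ := mem_L2_iff.1 hx
    exact mem_L2_iff_norm_eq_one.2 (by clear hx; revert p i s; decide)

theorem exists_mem_J_mul_move (i : Fin 2) (s : Bool) :
    ∃ j ∈ J, move i (!s) * move (1 - i) s = j * move i s :=
  ⟨MulAut.conj (if s then mk [(1 - i, true)] else mk [(i, true)]) * quarterTurn i s,
    J.mul_mem (conj_mem_J _) (isPermutation_quarterTurn i s).mem_J,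
    mulAut_ext (p := (0, true)) (q := (1, true)) (by decide) (by revert i s; decide)
      (by revert i s; decide)⟩

theorem exists_conj_mul_move (h : p.1 ≠ q.1) : ∃ (g : F2) (i : Fin 2) (s : Bool),
    (MulAut.conj g * move i s) (mk [p]) = mk [p] ∧
      (MulAut.conj g * move i s) (mk [q]) = mk [q] * mk [p] := by
  obtain ⟨j, t⟩ := q
  obtain ⟨i, s⟩ := p
  obtain rfl : i = 1 - j := by dsimp only at h; omega
  cases t
  · refine ⟨(mk [(1 - j, s)])⁻¹, j, !s, ?_, ?_⟩
    · simp [move_mk_of_ne (p := (1 - j, s)) _ h, -mul_mk, -inv_mk]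
    · rw [MulAut.mul_apply, MulAut.conj_apply, show (j, false) = bar (j, true) from rfl, mk_bar,
        map_inv (move j _), move_mk_self, show (1 - j, !s) = bar (1 - j, s) from rfl, mk_bar]
      group
  · exact ⟨1, j, s, by simpa using move_mk_of_ne s h, by simpa using move_mk_self j s⟩

theorem IsOneLetter.exists_move (h : IsOneLetter φ) :
    ∃ (g : F2) (i : Fin 2) (s : Bool), φ = MulAut.conj g * move i s := by
  obtain ⟨x, y, hx, hy, hφ⟩ := h
  obtain ⟨hyL, hyx⟩ := hy rfl
  obtain ⟨p, rfl⟩ := mem_L2_iff.1 hx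
  obtain ⟨q, rfl⟩ := mem_L2_iff.1 hyL
  have hpq : p.1 ≠ q.1 := fun h => hyx <| by
    rw [← mk_bar]
    exact (eq_or_eq_bar_of_fst_eq h.symm).imp (congrArg (mk [·])) (congrArg (mk [·]))
  obtain ⟨g, i, s, hp, hq⟩ := exists_conj_mul_move hpq
  refine ⟨g, i, s, mulAut_ext hpq ?_ ?_⟩
  · have h₁ : p ≠ q := fun h => hpq (by rw [h])
    have h₂ : bar p ≠ q := fun h => hpq (by rw [← h, bar_fst])
    rw [hp, hφ _ hx]
    simp [← mk_bar, mk_singleton_inj, h₁, h₂, -mul_mk, -inv_mk]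
  · rw [hq, hφ _ hyL]
    simp [← mk_bar, mk_singleton_inj, -mul_mk, -inv_mk]

theorem isOneLetter_move (i : Fin 2) (s : Bool) : IsOneLetter (move i s) := by
  have hi := ne_one_sub i
  refine ⟨mk [(1 - i, s)], mk [(i, true)], mem_L2_iff.2 ⟨_, rfl⟩, ?_, fun z hz => ?_⟩
  · rintro _ rfl
    refine ⟨mem_L2_iff.2 ⟨_, rfl⟩, ?_⟩
    simp [← mk_bar, mk_singleton_inj, bar, hi, -inv_mk]
  · obtain ⟨p, rfl⟩ := mem_L2_iff.1 hz
    rw [← mk_bar]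
    simp only [Set.mem_singleton_iff, mk_singleton_inj]
    by_cases hp : p.1 = i
    · rcases eq_or_eq_bar_of_fst_eq (y := (i, true)) hp with rfl | rfl
      · simp [move_mk_self, -mul_mk]
      · rw [mk_bar, map_inv, move_mk_self]
        simp [-mul_mk, -inv_mk]
    · have h₁ : p ≠ (i, true) := fun h => hp (by rw [h])
      have h₂ : bar p ≠ (i, true) := fun h => hp (by rw [← bar_fst, h])
      simp [move_mk_of_ne s hp, h₁, h₂]

end Moves

section NielsenTheorem

variable {φ : MulAut F2} {p q r : Fin 2 × Bool}

/-- The total length of the images of the two generators, which Nielsen reduction decreases. -/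
def basisLen (φ : MulAut F2) : ℕ := (φ (of 0)).norm + (φ (of 1)).norm

theorem norm_map_bar (φ : MulAut F2) (p : Fin 2 × Bool) :
    (φ (mk [bar p])).norm = (φ (mk [p])).norm := by
  rw [mk_bar, map_inv, norm_inv_eq]

theorem norm_map_add_norm_map (h : p.1 ≠ q.1) (φ : MulAut F2) :
    (φ (mk [p])).norm + (φ (mk [q])).norm = basisLen φ := by
  have key (r : Fin 2 × Bool) : (φ (mk [r])).norm = (φ (of r.1)).norm := by
    rcases eq_or_eq_bar_of_fst_eq (show r.1 = (r.1, true).1 from rfl) with hr | hr <;> rw [hr]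
    · rfl
    · exact norm_map_bar φ _
  obtain ⟨i, s⟩ := p
  obtain ⟨j, t⟩ := q
  rw [key, key, basisLen]
  fin_cases i <;> fin_cases j
  exacts [absurd rfl h, rfl, add_comm _ _, absurd rfl h]

/-- The subgroup generated by `J` and the automorphisms `move i s`. -/
def elementarySubgroup : Subgroup (MulAut F2) :=
  Subgroup.closure ((J : Set (MulAut F2)) ∪ {φ | ∃ i s, φ = move i s})

theorem J_le_elementarySubgroup : J ≤ elementarySubgroup :=
  fun _ h => Subgroup.subset_closure (.inl h)

theorem exists_mem_elementarySubgroup (h : p.1 ≠ q.1) : ∃ ψ ∈ elementarySubgroup,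
    ψ (mk [p]) = mk [p] ∧ ψ (mk [q]) = (mk [p])⁻¹ * mk [q] := by
  obtain ⟨g, i, s, hp, hq⟩ := exists_conj_mul_move (p := p) (q := bar q) h
  refine ⟨MulAut.conj g * move i s, elementarySubgroup.mul_mem
    (J_le_elementarySubgroup (conj_mem_J g)) (Subgroup.subset_closure (.inr ⟨i, s, rfl⟩)), hp, ?_⟩
  rw [← bar_bar q, mk_bar (bar q), map_inv, hq, mul_inv_rev]

theorem two_mul_commonPrefix_map_bar_lt (φ : MulAut F2) (r : Fin 2 × Bool) :
    2 * commonPrefix (φ (mk [bar r])) (φ (mk [r])) < (φ (mk [r])).norm := by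
  rw [mk_bar, map_inv]
  refine two_mul_commonPrefix_inv_lt ?_
  rw [Ne, map_eq_one_iff φ φ.injective]
  exact fun h => by simpa using congrArg FreeGroup.toWord h

theorem two_mul_commonPrefix_map_le
    (hmin : ∀ ψ ∈ elementarySubgroup, basisLen φ ≤ basisLen (φ * ψ)) (hpq : p ≠ q) :
    2 * commonPrefix (φ (mk [p])) (φ (mk [q])) ≤ (φ (mk [p])).norm := by
  by_cases h : p.1 = q.1
  · obtain rfl := (eq_or_eq_bar_of_fst_eq h).resolve_left hpq
    rw [norm_map_bar]
    exact (two_mul_commonPrefix_map_bar_lt φ q).le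
  · obtain ⟨ψ, hψ, hp, hq⟩ := exists_mem_elementarySubgroup h
    have hle := hmin ψ hψ
    rw [← norm_map_add_norm_map h, ← norm_map_add_norm_map h, MulAut.mul_apply, MulAut.mul_apply,
      hp, hq, map_mul, map_inv] at hle
    have := norm_inv_mul (φ (mk [p])) (φ (mk [q]))
    omega

theorem exists_basisLen_lt (h : r.1 ≠ p.1) (hle : (φ (mk [r])).norm ≤ (φ (mk [p])).norm)
    (hpre : 2 * commonPrefix (φ (mk [p])) (φ (mk [r])) = (φ (mk [r])).norm)
    (hsuf : 2 * commonPrefix (φ (mk [bar r])) (φ (mk [bar p])) = (φ (mk [r])).norm) :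
    ∃ χ ∈ elementarySubgroup, ∃ ψ ∈ elementarySubgroup,
      basisLen (χ * φ * ψ) < basisLen φ := by
  obtain ⟨P, Q, m, hr, hp, hQP, hm⟩ := exists_factorization_of_commonPrefix hpre hle rfl (by
    rw [← map_inv, ← map_inv, ← mk_bar, ← mk_bar]; omega)
  obtain ⟨ψ, hψ, hψr, hψp⟩ := exists_mem_elementarySubgroup h
  refine ⟨MulAut.conj Q, J_le_elementarySubgroup (conj_mem_J Q), ψ, hψ, ?_⟩
  have hr' : (MulAut.conj Q * φ * ψ) (mk [r]) = Q * P := by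
    rw [MulAut.mul_apply, hψr, MulAut.mul_apply, hr, MulAut.conj_apply]
    group
  have hp' : (MulAut.conj Q * φ * ψ) (mk [p]) = m := by
    rw [MulAut.mul_apply, hψp, MulAut.mul_apply, map_mul φ, map_inv φ, hr, hp, MulAut.conj_apply]
    group
  have := two_mul_commonPrefix_map_bar_lt φ r
  rw [← norm_map_add_norm_map h, ← norm_map_add_norm_map h, hr', hp']
  omega

theorem isNielsenReduced_of_forall_basisLen_le (hmin : ∀ χ ∈ elementarySubgroup,
    ∀ ψ ∈ elementarySubgroup, basisLen φ ≤ basisLen (χ * φ * ψ)) :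
    IsNielsenReduced (φ : F2 →* F2) := by
  have hhalf {p q : Fin 2 × Bool} (hpq : p ≠ q) :
      2 * commonPrefix (φ (mk [p])) (φ (mk [q])) ≤ (φ (mk [p])).norm :=
    two_mul_commonPrefix_map_le (fun ψ hψ => by simpa using hmin 1 (one_mem _) ψ hψ) hpq
  refine ⟨hhalf, fun {p r q} hr hq => ?_⟩
  simp only [MonoidHom.coe_coe]
  have hpre := hhalf hr
  have hsuf := hhalf hq.symm
  have hself := two_mul_commonPrefix_map_bar_lt φ r
  rw [commonPrefix_comm] at hpre
  rw [norm_map_bar] at hsuf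
  by_cases hpr : r.1 = p.1
  · obtain rfl := (eq_or_eq_bar_of_fst_eq hpr).resolve_right hr
    omega
  by_cases hqr : q.1 = r.1
  · obtain rfl := (eq_or_eq_bar_of_fst_eq hqr).resolve_right hq
    omega
  by_contra! hlt
  have hpq : q.1 = p.1 := (fst_eq_or_fst_eq hpr q).resolve_left hqr
  rcases eq_or_eq_bar_of_fst_eq hpq with rfl | rfl
  · have hle := hhalf hr.symm
    obtain ⟨χ, hχ, ψ, hψ, h⟩ := exists_basisLen_lt (φ := φ) (r := r) (p := bar q) hpr
      (by omega) (by omega) (by rw [bar_bar]; omega)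
    exact (hmin χ hχ ψ hψ).not_gt h
  · have := min_commonPrefix_le (φ (mk [bar r])) (φ (mk [bar p])) (φ (mk [r]))
    omega

theorem elementarySubgroup_eq_top : elementarySubgroup = ⊤ := by
  rw [Subgroup.eq_top_iff']
  intro φ
  induction h : basisLen φ using Nat.strong_induction_on generalizing φ with
  | _ n ih =>
  by_contra hφ
  refine hφ (J_le_elementarySubgroup (isPermutation_of_norm_le
    (isNielsenReduced_of_forall_basisLen_le fun χ hχ ψ hψ => ?_).norm_le).mem_J)
  by_contra! hlt
  have hmem := ih _ (h ▸ hlt) _ rfl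
  rw [Subgroup.mul_mem_cancel_right _ hψ, Subgroup.mul_mem_cancel_left _ hχ] at hmem
  exact hφ hmem

end NielsenTheorem

section MoveMonoid

variable {φ j : MulAut F2}

theorem mem_J_of_coe_eq (hj : j ∈ J) (h : (φ : MulAut F2 ⧸ Inn) = j) : φ ∈ J := by
  obtain ⟨g, hg⟩ := QuotientGroup.eq_iff_div_mem.1 h
  rw [← div_mul_cancel φ j, ← hg]
  exact J.mul_mem (conj_mem_J g) hj

theorem coe_conj_mul (g : F2) (φ : MulAut F2) :
    ((MulAut.conj g * φ : MulAut F2) : MulAut F2 ⧸ Inn) = φ :=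
  QuotientGroup.eq_iff_div_mem.2 (by simpa using ⟨g, rfl⟩)

theorem exists_move_mul_eq_mul_move (hj : j ∈ J) (k : Fin 2) (t : Bool) :
    ∃ j' ∈ J, ∃ (i : Fin 2) (s : Bool), move k t * j = j' * move i s := by
  obtain ⟨φ, hφ, he⟩ := IsOneLetter.conj_J (J.inv_mem hj) _ (isOneLetter_move k t)
  obtain ⟨g, i, s, rfl⟩ := hφ.exists_move
  refine ⟨move k t * j * (move i s)⁻¹, mem_J_of_coe_eq hj ?_, i, s, (inv_mul_cancel_right _ _).symm⟩
  rw [coe_conj_mul] at he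
  rw [QuotientGroup.mk_mul, QuotientGroup.mk_mul, QuotientGroup.mk_inv, he, QuotientGroup.mk_inv]
  group

/-- The monoid generated by the two automorphisms `move i s` of sign `s`. -/
def moveMonoid (s : Bool) : Submonoid (MulAut F2) := Submonoid.closure (Set.range (move · s))

theorem move_mem_moveMonoid (i : Fin 2) (s : Bool) : move i s ∈ moveMonoid s :=
  Submonoid.subset_closure ⟨i, rfl⟩

theorem exists_move_mul_eq_mul_mem_moveMonoid (i : Fin 2) (t : Bool) {s : Bool} {m : MulAut F2}
    (hm : m ∈ moveMonoid s) :
    ∃ j ∈ J, ∃ s', ∃ m' ∈ moveMonoid s', move i t * m = j * m' := by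
  rcases eq_or_ne t s with rfl | hts
  · exact ⟨1, J.one_mem, t, _, mul_mem (move_mem_moveMonoid i t) hm, (one_mul _).symm⟩
  obtain rfl := Bool.eq_not.2 hts
  induction hm using Submonoid.closure_induction_left with
  | one => exact ⟨1, J.one_mem, !s, _, move_mem_moveMonoid i _, by rw [one_mul, mul_one]⟩
  | mul_left n hn m hm _ =>
    obtain ⟨k, rfl⟩ := hn
    obtain rfl | rfl : k = i ∨ k = 1 - i := by omega
    · exact ⟨1, J.one_mem, s, m, hm, by rw [← inv_move, inv_mul_cancel_left, one_mul]⟩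
    · obtain ⟨j, hj, h⟩ := exists_mem_J_mul_move i s
      exact ⟨j, hj, s, _, mul_mem (move_mem_moveMonoid i s) hm, by rw [← mul_assoc, h, mul_assoc]⟩

theorem exists_eq_mul_mem_moveMonoid (φ : MulAut F2) :
    ∃ j ∈ J, ∃ s, ∃ m ∈ moveMonoid s, φ = j * m := by
  have hmove (i : Fin 2) (t : Bool) {φ : MulAut F2}
      (h : ∃ j ∈ J, ∃ s, ∃ m ∈ moveMonoid s, φ = j * m) :
      ∃ j ∈ J, ∃ s, ∃ m ∈ moveMonoid s, move i t * φ = j * m := by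
    obtain ⟨j, hj, s, m, hm, rfl⟩ := h
    obtain ⟨j₁, hj₁, k, s₁, h₁⟩ := exists_move_mul_eq_mul_move hj i t
    obtain ⟨j₂, hj₂, s₂, m₂, hm₂, h₂⟩ := exists_move_mul_eq_mul_mem_moveMonoid k s₁ hm
    exact ⟨j₁ * j₂, J.mul_mem hj₁ hj₂, s₂, m₂, hm₂,
      by rw [← mul_assoc, h₁, mul_assoc, h₂, mul_assoc]⟩
  have hφ : φ ∈ elementarySubgroup := elementarySubgroup_eq_top ▸ Subgroup.mem_top φ
  induction hφ using Subgroup.closure_induction_left with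
  | one => exact ⟨1, J.one_mem, true, 1, one_mem _, (one_mul _).symm⟩
  | mul_left x hx y _ ih =>
    rcases hx with hx | ⟨i, t, rfl⟩
    · obtain ⟨j, hj, s, m, hm, rfl⟩ := ih
      exact ⟨x * j, J.mul_mem hx hj, s, m, hm, (mul_assoc _ _ _).symm⟩
    · exact hmove i t ih
  | inv_mul_cancel x hx y _ ih =>
    rcases hx with hx | ⟨i, t, rfl⟩
    · obtain ⟨j, hj, s, m, hm, rfl⟩ := ih
      exact ⟨x⁻¹ * j, J.mul_mem (J.inv_mem hx) hj, s, m, hm, (mul_assoc _ _ _).symm⟩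
    · rw [inv_move]
      exact hmove i (!t) ih

end MoveMonoid

section Counts

variable {x y : Fin 2 × Bool} {l : List (Fin 2 × Bool)} {u w : F2}

/-- Every `x` but a final one starts a pair `xx`, `xy` or `xy⁻¹`, and every `x⁻¹` but an initial one
ends the inverse of such a pair. -/
theorem letterCount_add_eq_of_isReduced (hxy : x.1 ≠ y.1) {z : Fin 2 × Bool}
    (h : FreeGroup.IsReduced (l ++ [z])) :
    letterCount x l + (if z = bar x then 1 else 0) =
      pairCount x x (l ++ [z]) + pairCount x y (l ++ [z]) + pairCount x (bar y) (l ++ [z]) +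
        (if (l ++ [z]).head? = some (bar x) then 1 else 0) := by
  induction l with
  | nil => simp [letterCount, pairCount]
  | cons p t ih =>
    rw [List.cons_append, isReduced_cons_iff] at h
    specialize ih h.2
    obtain ⟨q, hq⟩ : ∃ q, (t ++ [z]).head? = some q :=
      Option.ne_none_iff_exists'.1 (by simp)
    have hstep : (if p = x then 1 else 0) + (if q = bar x then 1 else 0) =
        (if p = x ∧ q = x then 1 else 0) + (if p = bar x ∧ q = bar x then 1 else 0) +
        ((if p = x ∧ q = y then 1 else 0) + (if p = bar y ∧ q = bar x then 1 else 0)) +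
        ((if p = x ∧ q = bar y then 1 else 0) + (if p = y ∧ q = bar x then 1 else 0)) := by
      have hpq : q ≠ bar p := fun h' => h.1 (by rw [hq, h'])
      clear ih hq h
      revert x y p q
      decide
    simp only [List.cons_append, letterCount_cons, pairCount, hq, List.head?_cons,
      Option.some_inj, bar_bar] at ih ⊢
    omega

theorem letterCount_eq_of_isCyclicallyReduced (hxy : x.1 ≠ y.1) (h : IsCyclicallyReduced l) :
    letterCount x l =
      cyclicPairCount x x l + cyclicPairCount x y l + cyclicPairCount x (bar y) l := by
  cases l with
  | nil => rfl
  | cons p t =>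
    have hr : FreeGroup.IsReduced ((p :: t) ++ [p]) :=
      (h.flatten_replicate 2).isReduced.infix ⟨[], t, by simp [List.replicate_succ]⟩
    have := letterCount_add_eq_of_isReduced hxy hr
    simp only [List.cons_append, List.head?_cons, Option.some_inj] at this
    simp only [cyclicPairCount, List.take_succ_cons, List.take_zero, List.cons_append]
    omega

theorem cyclicPairCount_bar (x y : Fin 2 × Bool) (l : List (Fin 2 × Bool)) :
    cyclicPairCount (bar y) (bar x) l = cyclicPairCount x y l :=
  pairCount_bar x y _

theorem cyclicPairCount_comm (hxy : x.1 ≠ y.1) (h : IsCyclicallyReduced l) :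
    cyclicPairCount x y l = cyclicPairCount y x l := by
  have h₁ := letterCount_eq_of_isCyclicallyReduced hxy h
  have h₂ := letterCount_eq_of_isCyclicallyReduced (x := bar x) (y := bar y) hxy h
  have h₃ := letterCount_eq_of_isCyclicallyReduced hxy.symm h
  have h₄ := letterCount_eq_of_isCyclicallyReduced (x := bar y) (y := bar x) hxy.symm h
  have h₅ := cyclicPairCount_bar x (bar y) l
  have h₆ := cyclicPairCount_bar (bar x) y l
  simp only [bar_bar, letterCount_bar, cyclicPairCount_bar] at h₁ h₂ h₃ h₄ h₅ h₆
  omega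

/-- The number of cyclic occurrences in `w` of the square of the `i`th generator and of its
inverse. -/
def squareCount (i : Fin 2) (w : F2) : ℕ := cyclicPairCount (i, true) (i, true) w.toWord

/-- The number of cyclic occurrences in `w` of `ab` (for `s = true`) or `ab⁻¹` (for `s = false`) and
of its inverse. -/
def mixedCount (s : Bool) (w : F2) : ℕ := cyclicPairCount (0, true) (1, s) w.toWord

theorem cyclicPairCount_eq_mixedCount (i : Fin 2) (s : Bool) (hw : w ∈ C2) :
    cyclicPairCount (i, true) (1 - i, s) w.toWord = mixedCount s w := by
  fin_cases i
  · rfl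
  · cases s
    · exact cyclicPairCount_bar (0, true) (1, false) _
    · exact cyclicPairCount_comm (by decide) hw

theorem cyclicLen_move (i : Fin 2) (s : Bool) (hw : w ∈ C2) :
    cyclicLen (move i s w) + mixedCount (!s) w = len w + squareCount i w + mixedCount s w := by
  have hi := ne_one_sub i
  have h₁ := cyclicLen_transvection (y := (1 - i, s)) hi hw
  have h₂ := letterCount_eq_of_isCyclicallyReduced (x := (i, true)) (y := (1 - i, s)) hi hw
  rw [h₂] at h₁
  simp only [bar, cyclicPairCount_eq_mixedCount _ _ hw] at h₁
  simp only [move, squareCount]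
  change _ = w.norm + _ + _
  omega

theorem occurrences_add_occurrences_bar (x y : Fin 2 × Bool) (l : List (Fin 2 × Bool)) :
    occurrences [x, y] l + occurrences [bar y, bar x] l = pairCount x y l := by
  induction l with
  | nil => simp [occurrences, pairCount]
  | cons p t ih =>
    rw [pairCount, ← ih]
    cases t with
    | nil => simp [occurrences]
    | cons q t =>
      simp only [occurrences, List.tails_cons, List.countP_cons, List.isPrefixOf, Bool.and_true,
        Bool.and_eq_true, beq_iff_eq, List.head?_cons, Option.some_inj, eq_comm (a := x),
        eq_comm (a := y), eq_comm (a := bar x), eq_comm (a := bar y)]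
      omega

theorem subwordCount_eq_cyclicPairCount (hu : u.toWord = [x, y]) (hw : 2 ≤ len w) :
    subwordCount u w = cyclicPairCount x y w.toWord := by
  have hi : u⁻¹.toWord = [bar y, bar x] := by
    rw [FreeGroup.toWord_inv, hu]
    rfl
  have hl : len u = 2 := congrArg List.length hu
  rw [subwordCount, if_pos (hl ▸ hw), hl, hu, hi, occurrences_add_occurrences_bar, cyclicPairCount]

theorem subwordCount_eq_zero (h : len w < len u) : subwordCount u w = 0 := if_neg h.not_ge

end Counts

section JInvariance

theorem IsPermutation.norm_map_le {π : MulAut F2} (h : IsPermutation π) (w : F2) :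
    (π w).norm ≤ w.norm := by
  have key (l : List (Fin 2 × Bool)) : (π (mk l)).norm ≤ l.length := by
    induction l with
    | nil => rw [← FreeGroup.one_eq_mk, map_one, FreeGroup.norm_one]; rfl
    | cons p t ih =>
      have hp : (π (mk [p])).norm = 1 :=
        mem_L2_iff_norm_eq_one.1 (h.mem (mem_L2_iff.2 ⟨p, rfl⟩))
      rw [mk_cons, map_mul, List.length_cons]
      have := norm_mul_le (π (mk [p])) (π (mk t))
      omega
  exact (congrArg (fun v => (π v).norm) mk_toWord.symm).trans_le (key w.toWord)

theorem IsPermutation.norm_map {π : MulAut F2} (h : IsPermutation π) (w : F2) :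
    (π w).norm = w.norm :=
  (h.norm_map_le w).antisymm (by simpa using h.inv.norm_map_le (π w))

theorem IsPermutation.cyclicLen_map {π : MulAut F2} (h : IsPermutation π) (w : F2) :
    cyclicLen (π w) = cyclicLen w := by
  apply le_antisymm <;>
  exact cyclicLen_le_of_norm_pow_le 0 fun n => by simp [← map_pow, h.norm_map]

theorem cyclicLen_map_of_mem_J {j : MulAut F2} (hj : j ∈ J) (w : F2) :
    cyclicLen (j w) = cyclicLen w := by
  induction hj using Subgroup.closure_induction generalizing w with
  | mem x hx =>
    rcases hx with ⟨g, rfl⟩ | hx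
    · exact cyclicLen_conj g w
    · exact hx.cyclicLen_map w
  | one => rfl
  | mul x y _ _ hx hy => rw [MulAut.mul_apply, hx, hy]
  | inv x _ hx => rw [← hx, MulAut.apply_inv_self]

theorem cyclicLen_eq_of_JRel {v w : F2} (h : JRel v w) : cyclicLen v = cyclicLen w := by
  obtain ⟨j, hj, rfl⟩ := h
  exact (cyclicLen_map_of_mem_J hj v).symm

theorem cyclicLen_map_conj (φ : MulAut F2) (g w : F2) :
    cyclicLen (φ (g * w * g⁻¹)) = cyclicLen (φ w) := by
  simp only [map_mul, map_inv, cyclicLen_conj]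

end JInvariance

section Drift

variable {s : Bool} {w : F2} {m : MulAut F2}

/-- The length change separating the moves of sign `s` from those of the opposite sign. For a
cyclically reduced `w` it is twice `(ab)_w - (ab⁻¹)_w`, up to the sign `s`. -/
def drift (s : Bool) (w : F2) : ℤ := cyclicLen (move 0 s w) - cyclicLen (move 0 (!s) w)

theorem exists_conj_mem_C2 (w : F2) : ∃ g, g * w * g⁻¹ ∈ C2 := exists_conj_isCyclicallyReduced w

theorem len_eq_cyclicLen (hw : w ∈ C2) : len w = cyclicLen w :=
  (cyclicLen_of_isCyclicallyReduced hw).symm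

theorem drift_not (s : Bool) (w : F2) : drift (!s) w = -drift s w := by
  rw [drift, drift, Bool.not_not, neg_sub]

theorem move_not_move (i : Fin 2) (s : Bool) (w : F2) : move i (!s) (move i s w) = w := by
  rw [← inv_move, MulAut.inv_apply_self]

theorem drift_eq_sub (i : Fin 2) (s : Bool) (w : F2) :
    drift s w = cyclicLen (move i s w) - cyclicLen (move i (!s) w) := by
  obtain ⟨g, hg⟩ := exists_conj_mem_C2 w
  have h (k : Fin 2) (t : Bool) := cyclicLen_map_conj (move k t) g w ▸ cyclicLen_move k t hg
  have h₁ := h 0 s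
  have h₂ := h 0 (!s)
  have h₃ := h i s
  have h₄ := h i (!s)
  rw [Bool.not_not] at h₂ h₄
  rw [drift]
  omega

theorem two_mul_cyclicLen_le (i : Fin 2) (s : Bool) (w : F2) :
    2 * cyclicLen w ≤ cyclicLen (move i s w) + cyclicLen (move i (!s) w) := by
  obtain ⟨g, hg⟩ := exists_conj_mem_C2 w
  have h (k : Fin 2) (t : Bool) := cyclicLen_map_conj (move k t) g w ▸ cyclicLen_move k t hg
  have h₁ := h i s
  have h₂ := h i (!s)
  rw [len_eq_cyclicLen hg, cyclicLen_conj] at h₁ h₂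
  rw [Bool.not_not] at h₂
  omega

theorem drift_le_two_mul_sub (i : Fin 2) (s : Bool) (w : F2) :
    drift s w ≤ 2 * (cyclicLen (move i s w) - cyclicLen w) := by
  have := two_mul_cyclicLen_le i s w
  rw [drift_eq_sub i]
  omega

theorem two_mul_sub_le_drift_move (i : Fin 2) (s : Bool) (w : F2) :
    2 * (cyclicLen (move i s w) - cyclicLen w : ℤ) ≤ drift s (move i s w) := by
  have := drift_le_two_mul_sub i (!s) (move i s w)
  rw [move_not_move, drift_not] at this
  omega

theorem cyclicLen_le_of_drift_nonneg (hw : 0 ≤ drift s w) (hm : m ∈ moveMonoid s) :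
    cyclicLen w ≤ cyclicLen (m w) := by
  suffices cyclicLen w ≤ cyclicLen (m w) ∧ 0 ≤ drift s (m w) from this.1
  induction hm using Submonoid.closure_induction_left with
  | one => exact ⟨le_rfl, hw⟩
  | mul_left n hn m _ ih =>
    obtain ⟨i, rfl⟩ := hn
    have h₁ := drift_le_two_mul_sub i s (m w)
    have h₂ := two_mul_sub_le_drift_move i s (m w)
    simp only [MulAut.mul_apply]
    omega

theorem eq_one_of_drift_pos (hw : 0 < drift s w) (hm : m ∈ moveMonoid s)
    (h : cyclicLen (m w) ≤ cyclicLen w) : m = 1 := by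
  suffices m = 1 ∨ cyclicLen w < cyclicLen (m w) ∧ 0 < drift s (m w) from
    this.resolve_right fun h' => h'.1.not_ge h
  clear h
  induction hm using Submonoid.closure_induction_left with
  | one => exact .inl rfl
  | mul_left n hn m _ ih =>
    obtain ⟨i, rfl⟩ := hn
    have h₁ := drift_le_two_mul_sub i s (m w)
    have h₂ := two_mul_sub_le_drift_move i s (m w)
    simp only [MulAut.mul_apply]
    rcases ih with rfl | ih
    · simp only [MulAut.one_apply] at h₁ h₂ ⊢
      omega
    · omega

end Drift

section LevelTriangle

variable {s : Bool} {w : F2} {φ : MulAut F2}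

/-- Both moves of sign `s` preserve the cyclic length of `w`, so that `w` and its two images form a
triangle of words of equal cyclic length. -/
def IsLevelTriangle (s : Bool) (w : F2) : Prop := ∀ i, cyclicLen (move i s w) = cyclicLen w

/-- All four moves preserve the cyclic length of `w`; up to conjugation, `w` is then alternating. -/
def IsFlat (w : F2) : Prop := ∀ i s, cyclicLen (move i s w) = cyclicLen w

theorem IsLevelTriangle.drift_nonpos (h : IsLevelTriangle s w) : drift s w ≤ 0 := by
  have := drift_le_two_mul_sub 0 s w
  rw [h] at this
  omega

theorem IsLevelTriangle.isFlat (h : IsLevelTriangle s w) (hw : drift s w = 0) : IsFlat w := by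
  intro i t
  rcases Bool.eq_or_eq_not t s with rfl | rfl
  · exact h i
  · rw [drift_eq_sub i, h i] at hw
    omega

theorem IsLevelTriangle.drift_neg (h : IsLevelTriangle s w) (hw : ¬ IsFlat w) : drift s w < 0 :=
  h.drift_nonpos.lt_of_ne (mt h.isFlat hw)

theorem IsLevelTriangle.cyclicLen_lt_move_not (h : IsLevelTriangle s w) (hw : ¬ IsFlat w)
    (i : Fin 2) : cyclicLen w < cyclicLen (move i (!s) w) := by
  have := h.drift_neg hw
  rw [drift_eq_sub i, h i] at this
  omega

theorem jRel_move_not_move_one_sub (i : Fin 2) (s : Bool) (w : F2) :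
    JRel (move i s w) (move i (!s) (move (1 - i) s w)) := by
  obtain ⟨j, hj, h⟩ := exists_mem_J_mul_move i s
  exact ⟨j, hj, (DFunLike.congr_fun h w).symm⟩

theorem IsLevelTriangle.map_move (h : IsLevelTriangle s w) (i : Fin 2) :
    IsLevelTriangle (!s) (move i s w) := by
  intro k
  rw [h i]
  obtain rfl | rfl : i = k ∨ i = 1 - k := by omega
  · rw [move_not_move]
  · rw [← cyclicLen_eq_of_JRel (jRel_move_not_move_one_sub k s w), h k]

theorem IsLevelTriangle.cyclicLen_le (h : IsLevelTriangle s w) (φ : MulAut F2) :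
    cyclicLen w ≤ cyclicLen (φ w) := by
  obtain ⟨j, hj, t, m, hm, rfl⟩ := exists_eq_mul_mem_moveMonoid φ
  rw [MulAut.mul_apply, cyclicLen_map_of_mem_J hj]
  rcases Bool.eq_or_eq_not t s with rfl | rfl
  · induction hm using Submonoid.closure_induction_right with
    | one => rfl
    | mul_right m hm n hn _ =>
      obtain ⟨i, rfl⟩ := hn
      have := (h.map_move i).drift_nonpos
      rw [drift_not, neg_nonpos] at this
      exact (h i).ge.trans (cyclicLen_le_of_drift_nonneg this hm)
  · refine cyclicLen_le_of_drift_nonneg ?_ hm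
    rw [drift_not]
    exact neg_nonneg.2 h.drift_nonpos

/-- The words at the vertices of a level triangle. -/
def triangle (s : Bool) (w : F2) : Fin 3 → F2 := ![w, move 0 s w, move 1 s w]

theorem exists_automorphism_triangle (s : Bool) (w : F2) (k : Fin 3) :
    ∃ φ : MulAut F2, φ w = triangle s w k := by
  fin_cases k
  exacts [⟨1, rfl⟩, ⟨move 0 s, rfl⟩, ⟨move 1 s, rfl⟩]

theorem IsLevelTriangle.cyclicLen_triangle (h : IsLevelTriangle s w) (k : Fin 3) :
    cyclicLen (triangle s w k) = cyclicLen w := by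
  fin_cases k
  exacts [rfl, h 0, h 1]

theorem IsLevelTriangle.exists_jRel_move_triangle (h : IsLevelTriangle s w) (k : Fin 3) :
    ∃ t i, IsLevelTriangle t (triangle s w k) ∧
      JRel (move i t (triangle s w k)) (triangle s w (k + 1)) ∧
      JRel (move (1 - i) t (triangle s w k)) (triangle s w (k + 2)) := by
  have hmove (i : Fin 2) : JRel (move i (!s) (move i s w)) w := by
    rw [move_not_move]
    exact .refl w
  fin_cases k
  · exact ⟨s, 0, h, .refl _, .refl _⟩
  · exact ⟨!s, 1, h.map_move 0, (jRel_move_not_move_one_sub 1 s w).symm, hmove 0⟩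
  · exact ⟨!s, 1, h.map_move 1, hmove 1, (jRel_move_not_move_one_sub 0 s w).symm⟩

theorem IsLevelTriangle.exists_jRel_triangle (h : IsLevelTriangle s w)
    (hflat : ∀ k, ¬ IsFlat (triangle s w k)) (hφ : cyclicLen (φ w) ≤ cyclicLen w) :
    ∃ k, JRel (triangle s w k) (φ w) := by
  obtain ⟨j, hj, t, m, hm, rfl⟩ := exists_eq_mul_mem_moveMonoid φ
  rw [MulAut.mul_apply, cyclicLen_map_of_mem_J hj] at hφ
  rcases Bool.eq_or_eq_not t s with rfl | rfl
  · induction hm using Submonoid.closure_induction_right with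
    | one => exact ⟨0, j, hj, rfl⟩
    | mul_right m hm n hn _ =>
      obtain ⟨i, rfl⟩ := hn
      have hneg : drift (!t) (move i t w) < 0 :=
        (h.map_move i).drift_neg (by fin_cases i; exacts [hflat 1, hflat 2])
      rw [drift_not, neg_lt_zero] at hneg
      rw [eq_one_of_drift_pos hneg hm (hφ.trans (h i).ge)]
      fin_cases i
      exacts [⟨1, j, hj, rfl⟩, ⟨2, j, hj, rfl⟩]
  · have hpos : 0 < drift (!s) w := by
      rw [drift_not]
      exact neg_pos.2 (h.drift_neg (hflat 0))
    rw [eq_one_of_drift_pos hpos hm hφ]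
    exact ⟨0, j, hj, rfl⟩

end LevelTriangle

section Minimality

variable {w : F2}

theorem isMinimal_iff_forall_len_le_cyclicLen :
    IsMinimal w ↔ ∀ φ : MulAut F2, len w ≤ cyclicLen (φ w) := by
  refine ⟨fun h φ => ?_, fun h φ => (h φ).trans (cyclicLen_le_norm _)⟩
  obtain ⟨g, hg⟩ := exists_conj_mem_C2 (φ w)
  rw [← cyclicLen_conj g, ← len_eq_cyclicLen hg]
  exact h (MulAut.conj g * φ)

theorem isMinimal_of_len_le_one (h : len w ≤ 1) : IsMinimal w := by
  intro φ
  by_contra! hlt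
  have hφ : len (φ w) = 0 := by omega
  have hw : w = 1 := (map_eq_one_iff φ φ.injective).1 (FreeGroup.norm_eq_zero.1 hφ)
  simp [hw] at hlt

theorem exists_conj_isMinimal (h : ∀ φ : MulAut F2, cyclicLen w ≤ cyclicLen (φ w)) :
    ∃ g, g * w * g⁻¹ ∈ C2 ∧ IsMinimal (g * w * g⁻¹) := by
  obtain ⟨g, hg⟩ := exists_conj_mem_C2 w
  refine ⟨g, hg, isMinimal_iff_forall_len_le_cyclicLen.2 fun φ => ?_⟩
  rw [len_eq_cyclicLen hg, cyclicLen_conj, cyclicLen_map_conj]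
  exact h φ

theorem isAlternating_of_len_lt_two (hw : w ∈ C2) (h : len w < 2) : IsAlternating w :=
  ⟨hw, subwordCount_eq_zero h, subwordCount_eq_zero h⟩

theorem subwordCount_mul_self (i : Fin 2) (h : 2 ≤ len w) :
    subwordCount (of i * of i) w = squareCount i w :=
  subwordCount_eq_cyclicPairCount (by revert i; decide) h

theorem IsFlat.isAlternating (h : IsFlat w) (hw : w ∈ C2) : IsAlternating w := by
  rcases lt_or_ge (len w) 2 with h₂ | h₂
  · exact isAlternating_of_len_lt_two hw h₂
  · have hsq (i : Fin 2) : squareCount i w = 0 := by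
      have h₁ := cyclicLen_move i true hw
      have h₂ := cyclicLen_move i false hw
      rw [h, ← len_eq_cyclicLen hw] at h₁ h₂
      simp only [Bool.not_true, Bool.not_false] at h₁ h₂
      omega
    exact ⟨hw, (subwordCount_mul_self 0 h₂).trans (hsq 0),
      (subwordCount_mul_self 1 h₂).trans (hsq 1)⟩

theorem IsRootWord.exists_isLevelTriangle (h : IsRootWord w) (h₂ : 2 ≤ len w) :
    ∃ s, IsLevelTriangle s w := by
  obtain ⟨hw, hmixed, hsquare⟩ := h
  have haa : subwordCount (a * a) w = squareCount 0 w := subwordCount_mul_self 0 h₂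
  have hbb : subwordCount (b * b) w = squareCount 1 w := subwordCount_mul_self 1 h₂
  have hab : subwordCount (a * b) w = mixedCount true w :=
    subwordCount_eq_cyclicPairCount (by decide) h₂
  have hab' : subwordCount (a * b⁻¹) w = mixedCount false w :=
    subwordCount_eq_cyclicPairCount (by decide) h₂
  rw [haa, hab, hab'] at hmixed
  rw [haa, hbb] at hsquare
  have hi (i : Fin 2) : squareCount i w = squareCount 0 w := by
    fin_cases i
    exacts [rfl, hsquare.symm]
  obtain ⟨s, hs⟩ : ∃ s, mixedCount (!s) w = squareCount 0 w + mixedCount s w := by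
    rcases abs_cases ((mixedCount true w : ℤ) - mixedCount false w) with h | h
    · exact ⟨false, by rw [Bool.not_false]; omega⟩
    · exact ⟨true, by rw [Bool.not_true]; omega⟩
  refine ⟨s, fun i => ?_⟩
  have := cyclicLen_move i s hw
  rw [hi, len_eq_cyclicLen hw] at this
  omega

end Minimality

section Edges

variable {s : Bool} {u v w : F2} {φ ψ : MulAut F2}

theorem cyclicLen_eq_of_coe_eq (h : (φ : MulAut F2 ⧸ Inn) = ψ) (w : F2) :
    cyclicLen (φ w) = cyclicLen (ψ w) := by
  obtain ⟨g, hg⟩ := QuotientGroup.eq_iff_div_mem.1 h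
  rw [← div_mul_cancel φ ψ, ← hg]
  exact cyclicLen_conj g (ψ w)

theorem cyclicLen_mul_of_fst_ne {p q : Fin 2 × Bool} (h : p.1 ≠ q.1) :
    cyclicLen (mk [p] * mk [q]) = 2 := by
  rw [cyclicLen_of_isCyclicallyReduced]
  · simp [FreeGroup.norm, h]
  · simp [FreeGroup.isCyclicallyReduced_iff, h, h.symm]

theorem injective_coe_move (s : Bool) :
    Function.Injective fun i => ((move i s : MulAut F2) : MulAut F2 ⧸ Inn) := by
  intro i k h
  by_contra hik
  have hmove : cyclicLen (mk [(i, true)] * mk [(1 - i, s)]) = 2 :=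
    cyclicLen_mul_of_fst_ne (ne_one_sub i)
  have hfix : cyclicLen (mk [(i, true)]) = 1 :=
    cyclicLen_of_isCyclicallyReduced (by simp)
  have heq := cyclicLen_eq_of_coe_eq h (mk [(i, true)])
  rw [move_mk_self, move_mk_of_ne s (p := (i, true)) hik, hmove, hfix] at heq
  omega

theorem connecting_eq_image (h : ∀ i, ¬ JRel (move i (!s) u) v) :
    connecting u v = (fun i => ((move i s : MulAut F2) : MulAut F2 ⧸ Inn)) ''
      {i | JRel (move i s u) v} := by
  ext c
  constructor
  · rintro ⟨φ, hφ, rfl, hv⟩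
    obtain ⟨g, i, t, rfl⟩ := hφ.exists_move
    have hv' : JRel (move i t u) v := .trans ⟨_, conj_mem_J g, rfl⟩ hv
    rcases Bool.eq_or_eq_not t s with rfl | rfl
    · exact ⟨i, hv', (coe_conj_mul g _).symm⟩
    · exact absurd hv' (h i)
  · rintro ⟨i, hv, rfl⟩
    exact ⟨_, isOneLetter_move i s, rfl, hv⟩

open Classical in
theorem ncard_connecting (h : ∀ i, ¬ JRel (move i (!s) u) v) (i : Fin 2) :
    (connecting u v).ncard =
      (if JRel (move i s u) v then 1 else 0) + (if JRel (move (1 - i) s u) v then 1 else 0) := by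
  rw [connecting_eq_image h, Set.ncard_image_of_injective _ (injective_coe_move s),
    Set.ncard_eq_toFinset_card', Set.toFinset_ofPred, Finset.card_filter, Fin.sum_univ_two]
  fin_cases i
  · rfl
  · exact add_comm _ _

open Classical in
theorem IsLevelTriangle.ncard_connecting_triangle (h : IsLevelTriangle s w) {k : Fin 3}
    (hk : ¬ IsFlat (triangle s w k)) (hv : cyclicLen v = cyclicLen w) :
    (connecting (triangle s w k) v).ncard =
      (if JRel (triangle s w (k + 1)) v then 1 else 0) +
        (if JRel (triangle s w (k + 2)) v then 1 else 0) := by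
  obtain ⟨t, i, ht, h₁, h₂⟩ := h.exists_jRel_move_triangle k
  have hout (i : Fin 2) : ¬ JRel (move i (!t) (triangle s w k)) v := fun hJ => by
    have := ht.cyclicLen_lt_move_not hk i
    rw [cyclicLen_eq_of_JRel hJ, hv, h.cyclicLen_triangle] at this
    exact this.false
  have hiff {x y : F2} (hxy : JRel x y) : JRel x v ↔ JRel y v :=
    ⟨hxy.symm.trans, hxy.trans⟩
  simp only [ncard_connecting hout i, hiff h₁, hiff h₂]

end Edges

section Quotients

variable {G : DirectedMultigraph}

theorem DirectedMultigraph.isomorphic_of_bijective {n : ℕ} {e : Fin n → Fin n → ℕ}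
    {f : Fin n → G.V} (hf : f.Bijective) (h : ∀ i k, G.edges (f i) (f k) = e i k) :
    G.Isomorphic ⟨Fin n, e⟩ := by
  refine ⟨(Equiv.ofBijective f hf).symm, hf.surjective.forall₂.2 fun i k => ?_⟩
  rw [h, Equiv.ofBijective_symm_apply_apply, Equiv.ofBijective_symm_apply_apply]

variable {x : Fin 3 → G.V}

open Classical in
theorem DirectedMultigraph.isomorphic_R1 (hx : x.Surjective)
    (h : ∀ k v, G.edges (x k) v =
      (if x (k + 1) = v then 1 else 0) + (if x (k + 2) = v then 1 else 0))
    (hconst : ∀ k l, x k = x l) : G.Isomorphic R1 := by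
  refine isomorphic_of_bijective (f := fun _ => x 0)
    ⟨fun _ _ _ => Subsingleton.elim _ _, hx.forall.2 fun k => ⟨0, hconst 0 k⟩⟩ fun i k => ?_
  rw [h, hconst (0 + 1) 0, hconst (0 + 2) 0, if_pos rfl]
  fin_cases i
  fin_cases k
  rfl

open Classical in
theorem DirectedMultigraph.isomorphic_R2 (hx : x.Surjective)
    (h : ∀ k v, G.edges (x k) v =
      (if x (k + 1) = v then 1 else 0) + (if x (k + 2) = v then 1 else 0))
    {k : Fin 3} (heq : x (k + 1) = x (k + 2)) (hne : x k ≠ x (k + 1)) : G.Isomorphic R2 := by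
  have h₁ : k + 1 + 1 = k + 2 := by omega
  have h₂ : k + 1 + 2 = k := by omega
  refine isomorphic_of_bijective (f := ![x k, x (k + 1)]) ⟨?_, hx.forall.2 fun l => ?_⟩ ?_
  · intro i j hij
    fin_cases i <;> fin_cases j <;> simp_all
  · obtain rfl | rfl | rfl : l = k ∨ l = k + 1 ∨ l = k + 2 := by omega
    exacts [⟨0, rfl⟩, ⟨1, rfl⟩, ⟨1, heq⟩]
  · intro i j
    fin_cases i <;> fin_cases j <;> simp [h, h₁, h₂, ← heq, hne, hne.symm]

open Classical in
theorem DirectedMultigraph.isomorphic_R3 (hx : x.Bijective)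
    (h : ∀ k v, G.edges (x k) v =
      (if x (k + 1) = v then 1 else 0) + (if x (k + 2) = v then 1 else 0)) :
    G.Isomorphic R3 := by
  refine isomorphic_of_bijective hx fun k l => ?_
  simp only [h, hx.injective.eq_iff]
  revert k l
  decide

open Classical in
theorem DirectedMultigraph.isomorphic_of_triangle (hx : x.Surjective)
    (h : ∀ k v, G.edges (x k) v =
      (if x (k + 1) = v then 1 else 0) + (if x (k + 2) = v then 1 else 0)) :
    G.Isomorphic R1 ∨ G.Isomorphic R2 ∨ G.Isomorphic R3 := by
  by_cases hinj : x.Injective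
  · exact .inr (.inr (isomorphic_R3 ⟨hinj, hx⟩ h))
  obtain ⟨k, heq⟩ : ∃ k, x (k + 1) = x (k + 2) := by
    by_contra! hne
    refine hinj fun i j hij => ?_
    have h₀ := hne 0
    have h₁ := hne 1
    have h₂ := hne 2
    fin_cases i <;> fin_cases j <;> simp_all
  by_cases hk : x k = x (k + 1)
  · refine .inl (isomorphic_R1 hx h fun i j => ?_)
    have hall (i : Fin 3) : x i = x k := by
      obtain rfl | rfl | rfl : i = k ∨ i = k + 1 ∨ i = k + 2 := by omega
      exacts [rfl, hk.symm, (hk.trans heq).symm]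
    rw [hall i, hall j]
  · exact .inr (.inl (isomorphic_R2 hx h heq hk))

end Quotients

section Orbit

variable {s : Bool} {w : F2} {φ : MulAut F2} {W : Set F2}

/-- The vertex `[x]` of `Γ(W)`. -/
def vertex (x : MinimalWord W) : (Gam W).V := Quotient.mk (minimalSetoid W) x

theorem orbit_eq (ρ : MulAut F2) (w : F2) :
    {v | ∃ φ : MulAut F2, φ w = v} = {v | ∃ φ : MulAut F2, φ (ρ w) = v} := by
  ext v
  constructor
  · rintro ⟨φ, rfl⟩
    exact ⟨φ * ρ⁻¹, by simp⟩
  · rintro ⟨φ, rfl⟩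
    exact ⟨φ * ρ, rfl⟩

theorem IsLevelTriangle.exists_conj_isMinimal_triangle (h : IsLevelTriangle s w) (k : Fin 3) :
    ∃ φ : MulAut F2, (∃ g, φ w = g * triangle s w k * g⁻¹) ∧ φ w ∈ C2 ∧ IsMinimal (φ w) := by
  obtain ⟨ψ, hψ⟩ := exists_automorphism_triangle s w k
  obtain ⟨g, hC, hg⟩ := exists_conj_isMinimal (w := triangle s w k) fun φ => by
    rw [h.cyclicLen_triangle, ← hψ]
    exact h.cyclicLen_le (φ * ψ)
  have hφ : (MulAut.conj g * ψ) w = g * triangle s w k * g⁻¹ := congrArg (MulAut.conj g) hψ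
  exact ⟨_, ⟨g, hφ⟩, hφ ▸ hC, hφ ▸ hg⟩

theorem IsLevelTriangle.cyclicLen_eq_of_isMinimal (h : IsLevelTriangle s w)
    (hφ : IsMinimal (φ w)) : cyclicLen (φ w) = cyclicLen w := by
  refine le_antisymm ?_ (h.cyclicLen_le φ)
  have := isMinimal_iff_forall_len_le_cyclicLen.1 hφ φ⁻¹
  rw [MulAut.inv_apply_self] at this
  exact (cyclicLen_le_norm _).trans this

theorem vertex_surjective : (vertex (W := W)).Surjective :=
  Quotient.mk_surjective

theorem vertex_eq_vertex {x y : MinimalWord W} : vertex x = vertex y ↔ JRel x.1 y.1 :=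
  Quotient.eq

theorem IsLevelTriangle.Gam_isomorphic (h : IsLevelTriangle s w)
    (hflat : ∀ k, ¬ IsFlat (triangle s w k)) :
    (Gam {v | ∃ φ : MulAut F2, φ w = v}).Isomorphic R1 ∨
      (Gam {v | ∃ φ : MulAut F2, φ w = v}).Isomorphic R2 ∨
        (Gam {v | ∃ φ : MulAut F2, φ w = v}).Isomorphic R3 := by
  classical
  have hvertex (k : Fin 3) : ∃ v : MinimalWord {v | ∃ φ : MulAut F2, φ w = v},
      JRel (triangle s w k) v.1 := by
    obtain ⟨φ, ⟨g, hg⟩, -, hφ⟩ := h.exists_conj_isMinimal_triangle k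
    exact ⟨⟨φ w, ⟨φ, rfl⟩, hφ⟩, _, conj_mem_J g, hg.symm⟩
  have hlen (v : MinimalWord {v | ∃ φ : MulAut F2, φ w = v}) : cyclicLen v.1 = cyclicLen w := by
    obtain ⟨_, ⟨φ, rfl⟩, hφ⟩ := v
    exact h.cyclicLen_eq_of_isMinimal hφ
  choose x hx using hvertex
  have hclass (k : Fin 3) (v) : JRel (triangle s w k) v.1 ↔ vertex (x k) = vertex v := by
    rw [vertex_eq_vertex]
    exact ⟨(hx k).symm.trans, (hx k).trans⟩
  refine DirectedMultigraph.isomorphic_of_triangle (x := fun k => vertex (x k))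
    (vertex_surjective.forall.2 fun v => ?_) fun k => vertex_surjective.forall.2 fun v => ?_
  · obtain ⟨φ, hφ⟩ := v.2.1
    obtain ⟨k, hk⟩ := h.exists_jRel_triangle hflat (φ := φ) (hφ ▸ (hlen v).le)
    exact ⟨k, (hclass k v).1 (hφ ▸ hk)⟩
  · simp only [← hclass]
    rw [← h.ncard_connecting_triangle (hflat k) (hlen v)]
    exact (ncard_connecting_congr (hx k) (.refl _)).symm

end Orbit

end FreeGroupTwo

theorem theorem3 (W : Set FreeGroupTwo.F2) (hW : FreeGroupTwo.IsRootClass W)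
    (hna : ¬ ∃ w ∈ W, FreeGroupTwo.IsMinimal w ∧ FreeGroupTwo.IsAlternating w) :
    (FreeGroupTwo.Gam W).Isomorphic FreeGroupTwo.R1 ∨
      (FreeGroupTwo.Gam W).Isomorphic FreeGroupTwo.R2 ∨
      (FreeGroupTwo.Gam W).Isomorphic FreeGroupTwo.R3 := by
  open FreeGroupTwo in
  obtain ⟨⟨w₀, rfl⟩, _, ⟨ρ, rfl⟩, hroot⟩ := hW
  rw [orbit_eq ρ] at hna ⊢
  set w := ρ w₀
  have hlen : 2 ≤ len w := by
    by_contra! hlt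
    exact hna ⟨w, ⟨1, rfl⟩, isMinimal_of_len_le_one (by omega),
      isAlternating_of_len_lt_two hroot.1 hlt⟩
  obtain ⟨s, hs⟩ := hroot.exists_isLevelTriangle hlen
  refine hs.Gam_isomorphic fun k hflat => hna ?_
  obtain ⟨φ, ⟨g, hg⟩, hC, hφ⟩ := hs.exists_conj_isMinimal_triangle k
  refine ⟨φ w, ⟨φ, rfl⟩, hφ, IsFlat.isAlternating (fun i t => ?_) hC⟩
  rw [hg, cyclicLen_map_conj, cyclicLen_conj, hflat]
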